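/- Let ${\mathcal A}$ be a finite set of linear hyperplanes in $\mathbb R^d$. The regions of ${\mathcal A}$ are the closures of the connected components of $\mathbb R^d\setminus\bigcup{\mathcal A}$. Assume that ${\mathcal A}$ is simplicial: every region is the nonnegative linear span of a linearly independent set of vectors. Fix a region $B$ of ${\mathcal A}$ (the base region). For distinct $H,H'\in{\mathcal A}$, the rank-two subarrangement containing $H$ and $H'$ is $\{K\in{\mathcal A}: K\supseteq H\cap H'\}$. The basic hyperplanes of a rank-two subarrangement ${\mathcal A}'$ are the two hyperplanes of ${\mathcal A}'$ that bound the region of ${\mathcal A}'$ containing $B$. A hyperplane $H\in{\mathcal A}$ cuts a hyperplane $H'\in{\mathcal A}$, $H'\neq H$, if $H$ is basic and $H'$ is not basic in the rank-two subarrangement containing $H$ and $H'$. The shards in $H\in{\mathcal A}$ are the closures of the connected components of $H\setminus\bigcup\{H'\in{\mathcal A}: H'\text{ cuts }H\}$, and the shards of ${\mathcal A}$ are the shards in all the hyperplanes $H\in{\mathcal A}$. For a shard $\Sigma$, let $H_\Sigma$ be the hyperplane of ${\mathcal A}$ containing $\Sigma$. Two shards are compatible if their relative interiors have nonempty intersection.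 The shard digraph is the directed graph on the set of all shards with an arrow $\Sigma_1\to\Sigma_2$ if and only if $H_{\Sigma_1}$ cuts $H_{\Sigma_2}$ and $\Sigma_1\cap\Sigma_2$ has codimension $2$ in $\mathbb R^d$. Theorem. Let $\Sigma_1$ and $\Sigma_2$ be shards of ${\mathcal A}$. Then $\Sigma_1\to\Sigma_2$ in the shard digraph if and only if there exists a shard $\Sigma_1'$ satisfying all of the following conditions: (i) $\Sigma_1$ and $\Sigma_1'$ are compatible; (ii) $H_{\Sigma_1}\neq H_{\Sigma_1'}$, and $H_{\Sigma_2}$ is in the rank-two subarrangement containing $H_{\Sigma_1}$ and $H_{\Sigma_1'}$ but is not basic in that subarrangement; (iii) $\Sigma_1\cap\Sigma_1'\subseteq\Sigma_2$. -/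

import Mathlib

namespace HypArr

/-- A linear hyperplane of `ℝ^d`: a linear subspace of dimension `d - 1`. -/
def IsHyperplane {d : ℕ} (H : Submodule ℝ (EuclideanSpace ℝ (Fin d))) : Prop :=
  Module.finrank ℝ H + 1 = d

/-- A (real, central) hyperplane arrangement: a finite set of linear hyperplanes of `ℝ^d`. -/
structure IsArrangement {d : ℕ} (A : Set (Submodule ℝ (EuclideanSpace ℝ (Fin d)))) : Prop where
  finite : A.Finite
  isHyperplane : ∀ H ∈ A, IsHyperplane H

/-- The complement in `ℝ^d` of the union of the hyperplanes of `A`. -/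
def complement {d : ℕ} (A : Set (Submodule ℝ (EuclideanSpace ℝ (Fin d)))) :
    Set (EuclideanSpace ℝ (Fin d)) :=
  {x | ∀ H ∈ A, x ∉ H}

/-- The regions of `A`: the closures of the connected components of the complement of `A`. -/
def IsRegion {d : ℕ} (A : Set (Submodule ℝ (EuclideanSpace ℝ (Fin d))))
    (R : Set (EuclideanSpace ℝ (Fin d))) : Prop :=
  ∃ x ∈ complement A, R = closure (connectedComponentIn (complement A) x)

/-- A simplicial cone: the nonnegative linear span of a linearly independent set of vectors. -/
def IsSimplicialCone {d : ℕ} (R : Set (EuclideanSpace ℝ (Fin d))) : Prop :=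
  ∃ s : Set (EuclideanSpace ℝ (Fin d)), LinearIndepOn ℝ id s ∧
    R = (PointedCone.hull ℝ s : Set (EuclideanSpace ℝ (Fin d)))

/-- An arrangement is simplicial if each of its regions is a simplicial cone. -/
def IsSimplicial {d : ℕ} (A : Set (Submodule ℝ (EuclideanSpace ℝ (Fin d)))) : Prop :=
  ∀ R, IsRegion A R → IsSimplicialCone R

/-- The (convex) set `S` has codimension `k` in `ℝ^d`: its affine hull has dimension `d - k`. -/
def HasCodim {d : ℕ} (S : Set (EuclideanSpace ℝ (Fin d))) (k : ℕ) : Prop :=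
  S.Nonempty ∧ Module.finrank ℝ (affineSpan ℝ S).direction + k = d

/-- A rank-two subarrangement of `A`: a subset with more than one element, consisting of all the
hyperplanes of `A` that contain a given linear subspace of codimension two. -/
def IsRankTwoSubarrangement {d : ℕ} (A A' : Set (Submodule ℝ (EuclideanSpace ℝ (Fin d)))) :
    Prop :=
  A'.Nontrivial ∧ ∃ U : Submodule ℝ (EuclideanSpace ℝ (Fin d)),
    Module.finrank ℝ U + 2 = d ∧ A' = {H ∈ A | U ≤ H}

/-- For distinct `H₁, H₂` in `A`, the rank-two subarrangement of `A` containing `H₁` and `H₂`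
(see `isRankTwoSubarrangement_rankTwo` and `eq_rankTwo`). -/
def rankTwo {d : ℕ} (A : Set (Submodule ℝ (EuclideanSpace ℝ (Fin d))))
    (H₁ H₂ : Submodule ℝ (EuclideanSpace ℝ (Fin d))) :
    Set (Submodule ℝ (EuclideanSpace ℝ (Fin d))) :=
  {H ∈ A | H₁ ⊓ H₂ ≤ H}

theorem finrank_inf_add_two {d : ℕ} {H₁ H₂ : Submodule ℝ (EuclideanSpace ℝ (Fin d))}
    (h₁ : IsHyperplane H₁) (h₂ : IsHyperplane H₂) (hne : H₁ ≠ H₂) :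
    Module.finrank ℝ (H₁ ⊓ H₂ : Submodule ℝ (EuclideanSpace ℝ (Fin d))) + 2 = d := by
  unfold IsHyperplane at h₁ h₂
  have hd : Module.finrank ℝ (EuclideanSpace ℝ (Fin d)) = d := by simp
  have hle := Submodule.finrank_le (H₁ ⊔ H₂)
  have hsum := Submodule.finrank_sup_add_finrank_inf_eq H₁ H₂
  have hlt : Module.finrank ℝ H₁ <
      Module.finrank ℝ (H₁ ⊔ H₂ : Submodule ℝ (EuclideanSpace ℝ (Fin d))) := by
    apply Submodule.finrank_lt_finrank_of_lt
    refine lt_of_le_of_ne le_sup_left fun h => hne ?_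
    have h21 : H₂ ≤ H₁ := by rw [h]; exact le_sup_right
    exact (Submodule.eq_of_le_of_finrank_eq h21 (by omega)).symm
  omega

theorem isRankTwoSubarrangement_rankTwo {d : ℕ}
    {A : Set (Submodule ℝ (EuclideanSpace ℝ (Fin d)))} (hA : IsArrangement A)
    {H₁ H₂ : Submodule ℝ (EuclideanSpace ℝ (Fin d))} (h₁ : H₁ ∈ A) (h₂ : H₂ ∈ A)
    (hne : H₁ ≠ H₂) : IsRankTwoSubarrangement A (rankTwo A H₁ H₂) :=
  ⟨⟨H₁, ⟨h₁, inf_le_left⟩, H₂, ⟨h₂, inf_le_right⟩, hne⟩, H₁ ⊓ H₂,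
    finrank_inf_add_two (hA.isHyperplane _ h₁) (hA.isHyperplane _ h₂) hne, rfl⟩

theorem eq_rankTwo {d : ℕ}
    {A A' : Set (Submodule ℝ (EuclideanSpace ℝ (Fin d)))} (hA : IsArrangement A)
    (hA' : IsRankTwoSubarrangement A A')
    {H₁ H₂ : Submodule ℝ (EuclideanSpace ℝ (Fin d))} (h₁ : H₁ ∈ A') (h₂ : H₂ ∈ A')
    (hne : H₁ ≠ H₂) : A' = rankTwo A H₁ H₂ := by
  obtain ⟨-, U, hU, rfl⟩ := hA'
  have hf := finrank_inf_add_two (hA.isHyperplane _ h₁.1) (hA.isHyperplane _ h₂.1) hne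
  have : U = H₁ ⊓ H₂ := Submodule.eq_of_le_of_finrank_eq (le_inf h₁.2 h₂.2) (by omega)
  rw [this]; rfl

/-- `H` is basic in the (rank-two) subarrangement `A'` with respect to the base region `B`:
`H ∈ A'` and `H` bounds the region `B'` of `A'` that contains `B`, that is, `H ∩ B'` is a facet
of `B'`. -/
def IsBasic {d : ℕ} (A' : Set (Submodule ℝ (EuclideanSpace ℝ (Fin d))))
    (B : Set (EuclideanSpace ℝ (Fin d))) (H : Submodule ℝ (EuclideanSpace ℝ (Fin d))) : Prop :=
  H ∈ A' ∧ ∃ B', IsRegion A' B' ∧ B ⊆ B' ∧ HasCodim ((H : Set (EuclideanSpace ℝ (Fin d))) ∩ B') 1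

/-- `H₁` cuts `H₂`: in the rank-two subarrangement containing the two (distinct) hyperplanes,
`H₁` is basic and `H₂` is not. -/
def Cuts {d : ℕ} (A : Set (Submodule ℝ (EuclideanSpace ℝ (Fin d))))
    (B : Set (EuclideanSpace ℝ (Fin d))) (H₁ H₂ : Submodule ℝ (EuclideanSpace ℝ (Fin d))) :
    Prop :=
  H₁ ∈ A ∧ H₂ ∈ A ∧ H₁ ≠ H₂ ∧ IsBasic (rankTwo A H₁ H₂) B H₁ ∧ ¬ IsBasic (rankTwo A H₁ H₂) B H₂

/-- The part of `H` that remains after removing all the hyperplanes of `A` that cut `H`. -/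
def uncut {d : ℕ} (A : Set (Submodule ℝ (EuclideanSpace ℝ (Fin d))))
    (B : Set (EuclideanSpace ℝ (Fin d))) (H : Submodule ℝ (EuclideanSpace ℝ (Fin d))) :
    Set (EuclideanSpace ℝ (Fin d)) :=
  {x | x ∈ H ∧ ∀ H', Cuts A B H' H → x ∉ H'}

/-- A shard of `A` (with respect to the base region `B`): a hyperplane `H` of `A` together with
the closure of a connected component of `H` minus the hyperplanes that cut `H`. The field
`hyperplane` is `H_Σ`; it is the linear span of the shard, hence determined by the shard as
a set. -/
@[ext]
structure Shard {d : ℕ} (A : Set (Submodule ℝ (EuclideanSpace ℝ (Fin d))))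
    (B : Set (EuclideanSpace ℝ (Fin d))) where
  hyperplane : Submodule ℝ (EuclideanSpace ℝ (Fin d))
  carrier : Set (EuclideanSpace ℝ (Fin d))
  hyperplane_mem : hyperplane ∈ A
  isComponent : ∃ x ∈ uncut A B hyperplane,
    carrier = closure (connectedComponentIn (uncut A B hyperplane) x)

/-- Two shards are compatible if their relative interiors meet. -/
def Shard.Compatible {d : ℕ} {A : Set (Submodule ℝ (EuclideanSpace ℝ (Fin d)))}
    {B : Set (EuclideanSpace ℝ (Fin d))} (S T : Shard A B) : Prop :=
  (intrinsicInterior ℝ S.carrier ∩ intrinsicInterior ℝ T.carrier).Nonempty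

/-- The shard digraph: `Σ₁ → Σ₂` if and only if `H_{Σ₁}` cuts `H_{Σ₂}` and `Σ₁ ∩ Σ₂` has
codimension two. -/
def shardDigraph {d : ℕ} (A : Set (Submodule ℝ (EuclideanSpace ℝ (Fin d))))
    (B : Set (EuclideanSpace ℝ (Fin d))) : Digraph (Shard A B) where
  Adj S T := Cuts A B S.hyperplane T.hyperplane ∧ HasCodim (S.carrier ∩ T.carrier) 2

end HypArr

namespace HypArr

/-! ### Perturbation and sign cells -/

/-! Pick `b` inside the base region and scale the normal `ν H` of each hyperplane so that `ν H b =
1`. Regions and shards become closed sign cells. A hyperplane is basic exactly when it contains a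
point at which all other normals of the subarrangement are positive (`isBasic_iff`). In rank two
there are two such hyperplanes, and every other normal is a positive combination of theirs
(`exists_basic_pair`).

From the triple to the arrow (`adj_of_compatible`): if `x` is in both relative interiors, `H₁` and
`H₁'` are basic, since otherwise a basic hyperplane through `x` would cut one of them. Hence `H₁`
cuts `H₂`, and a neighbourhood of `x` in `H₁ ⊓ H₁'` lies in both `Σ₁` and `Σ₁'`, hence in `Σ₂`.

From the arrow to the triple (`exists_compatible_of_adj`): let `H₁'` be the other basic hyperplane,
`x` a generic point of `Σ₁ ∩ Σ₂`, and `Σ₁'` the shard of `H₁'` through `x`. If some `y` in `Σ₁ ∩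
Σ₁'` were outside `Σ₂`, a cutter `K` of `H₂` not containing `H₁ ⊓ H₂` would separate `x` from `y`.
The segment would cross `K` at a point `z` relatively interior to both `Σ₁` and `Σ₁'`. Keep only the
hyperplanes through `z`. Simpliciality makes the uncut `H₁` and `H₁'` walls of the region around `b`
(`exists_facet_point`), so their normals span a face of the cone of normals. The normal of `H₂` lies
in that span and is also a positive combination involving `K`; thus `K` contains `H₁ ⊓ H₁'`
(`inf_le_of_cuts`), a contradiction. -/

theorem exists_pos_forall_add_mul_pos {ι : Type*} {T : Set ι} (hT : T.Finite) (a b : ι → ℝ) :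
    ∃ ε > 0, ∀ i ∈ T, 0 < a i → 0 < a i + ε * b i := by
  have h : ∀ i ∈ T, ∀ᶠ ε : ℝ in nhdsWithin 0 (Set.Ioi 0), 0 < a i → 0 < a i + ε * b i := by
    intro i _
    by_cases ha : 0 < a i
    · have hc : Filter.Tendsto (fun ε : ℝ => a i + ε * b i) (nhdsWithin 0 (Set.Ioi 0))
          (nhds (a i + 0 * b i)) :=
        (Continuous.tendsto (by fun_prop) 0).mono_left nhdsWithin_le_nhds
      have := hc.eventually (lt_mem_nhds (show 0 < a i + 0 * b i by simpa using ha))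
      filter_upwards [this] with ε hε _ using hε
    · exact Filter.Eventually.of_forall fun ε h => absurd h ha
  have h2 := (Filter.eventually_all_finite hT).2 h
  obtain ⟨ε, h3, h4⟩ := (h2.and self_mem_nhdsWithin).exists
  exact ⟨ε, h4, h3⟩

section Cells

variable {E : Type*} [NormedAddCommGroup E] [NormedSpace ℝ E] {ι : Type*}

/-- A convex cone on which none of finitely many functionals vanishes identically contains a point
at which none of them vanishes. -/
theorem exists_mem_forall_ne_zero {C : Set E}
    (hC : ∀ x ∈ C, ∀ y ∈ C, ∀ ε : ℝ, 0 < ε → x + ε • y ∈ C)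
    (hne : C.Nonempty) {T : Set ι} (hT : T.Finite) (ν : ι → E →L[ℝ] ℝ)
    (h : ∀ i ∈ T, ∃ y ∈ C, ν i y ≠ 0) : ∃ x ∈ C, ∀ i ∈ T, ν i x ≠ 0 := by
  induction T, hT using Set.Finite.induction_on with
  | empty => obtain ⟨x, hx⟩ := hne; exact ⟨x, hx, by simp⟩
  | @insert a T ha hT ih =>
    obtain ⟨x, hx, hx'⟩ := ih fun i hi => h i (Set.mem_insert_of_mem _ hi)
    by_cases h0 : ν a x = 0
    · obtain ⟨y, hy, hy'⟩ := h a (Set.mem_insert _ _)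
      obtain ⟨ε, hε, hε'⟩ := exists_pos_forall_add_mul_pos hT (fun i => ν i x * ν i x)
        (fun i => ν i x * ν i y)
      refine ⟨x + ε • y, hC x hx y hy ε hε, ?_⟩
      rintro i (rfl | hi)
      · simp [h0, hε.ne', hy']
      · intro h1
        have h2 := hε' i hi (mul_self_pos.2 (hx' i hi))
        have h3 : ν i x * ν i x + ε * (ν i x * ν i y) = ν i x * ν i (x + ε • y) := by
          simp; ring
        rw [h3, h1] at h2
        simp at h2
    · refine ⟨x, hx, ?_⟩
      rintro i (rfl | hi)
      · exact h0
      · exact hx' i hi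

/-- The closed cell of `x` in the subspace `W` cut by the functionals `ν i`, `i ∈ T`. -/
def cell (W : Submodule ℝ E) (T : Set ι) (ν : ι → E →L[ℝ] ℝ) (x : E) : Set E :=
  {y | y ∈ W ∧ ∀ i ∈ T, 0 ≤ ν i x * ν i y}

theorem add_smul_mem_cell {W : Submodule ℝ E} {T : Set ι} {ν : ι → E →L[ℝ] ℝ} {x y z : E}
    (hy : y ∈ cell W T ν x) (hz : z ∈ cell W T ν x) {ε : ℝ} (hε : 0 < ε) :
    y + ε • z ∈ cell W T ν x := by
  refine ⟨W.add_mem hy.1 (W.smul_mem _ hz.1), fun i hi => ?_⟩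
  have h1 := hy.2 i hi
  have h2 := mul_nonneg hε.le (hz.2 i hi)
  simp only [map_add, map_smul, smul_eq_mul]
  linarith

theorem self_mem_cell {W : Submodule ℝ E} {T : Set ι} {ν : ι → E →L[ℝ] ℝ} {x : E} (hx : x ∈ W) :
    x ∈ cell W T ν x := ⟨hx, fun _ _ => mul_self_nonneg _⟩

theorem cell_eq_of_mem {W : Submodule ℝ E} {T : Set ι} {ν : ι → E →L[ℝ] ℝ} {x y : E}
    (hx : ∀ i ∈ T, ν i x ≠ 0) (hy : y ∈ cell W T ν x) (hy' : ∀ i ∈ T, ν i y ≠ 0) :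
    cell W T ν x = cell W T ν y := by
  ext z
  refine and_congr_right fun _ => forall₂_congr fun i hi => ?_
  have h1 : 0 < ν i x * ν i y := lt_of_le_of_ne (hy.2 i hi) (mul_ne_zero (hx i hi) (hy' i hi)).symm
  rcases pos_and_pos_or_neg_and_neg_of_mul_pos h1 with ⟨h2, h3⟩ | ⟨h2, h3⟩
  · rw [mul_nonneg_iff_of_pos_left h2, mul_nonneg_iff_of_pos_left h3]
  · rw [← neg_mul_neg, mul_nonneg_iff_of_pos_left (neg_pos.2 h2), ← neg_mul_neg (ν i y),
      mul_nonneg_iff_of_pos_left (neg_pos.2 h3)]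

/-- A functional that never vanishes keeps its sign on a connected set; conversely the open cell is
convex. -/
theorem connectedComponentIn_cell {W : Submodule ℝ E} {T : Set ι} {ν : ι → E →L[ℝ] ℝ} {x : E}
    (hx : x ∈ W ∧ ∀ i ∈ T, ν i x ≠ 0) :
    connectedComponentIn {y | y ∈ W ∧ ∀ i ∈ T, ν i y ≠ 0} x =
      {y | y ∈ W ∧ ∀ i ∈ T, 0 < ν i x * ν i y} := by
  apply Set.Subset.antisymm
  · intro y hy
    have hsub := connectedComponentIn_subset {y | y ∈ W ∧ ∀ i ∈ T, ν i y ≠ 0} x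
    refine ⟨(hsub hy).1, fun i hi => ?_⟩
    by_contra hneg
    have hpc : IsPreconnected (connectedComponentIn {y | y ∈ W ∧ ∀ i ∈ T, ν i y ≠ 0} x) :=
      isPreconnected_connectedComponentIn
    have hxx := mem_connectedComponentIn (F := {y | y ∈ W ∧ ∀ i ∈ T, ν i y ≠ 0}) hx
    have := hpc.intermediate_value hy hxx (f := fun y => ν i x * ν i y)
      (by fun_prop) ⟨not_lt.1 hneg, mul_self_nonneg (ν i x)⟩
    obtain ⟨z, hz, hz'⟩ := this
    exact mul_ne_zero (hx.2 i hi) ((hsub hz).2 i hi) hz'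
  · apply IsPreconnected.subset_connectedComponentIn
    · apply Convex.isPreconnected
      intro y hy z hz a b ha hb hab
      refine ⟨W.add_mem (W.smul_mem _ hy.1) (W.smul_mem _ hz.1), fun i hi => ?_⟩
      have h1 := hy.2 i hi
      have h2 := hz.2 i hi
      simp only [map_add, map_smul, smul_eq_mul]
      rcases ha.eq_or_lt with rfl | ha
      · have : b = 1 := by linarith
        subst this; linarith
      · nlinarith [mul_pos ha h1, mul_nonneg hb h2.le]
    · exact ⟨hx.1, fun i hi => mul_self_pos.2 (hx.2 i hi)⟩
    · intro y hy
      exact ⟨hy.1, fun i hi h0 => by simpa [h0] using hy.2 i hi⟩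

theorem closure_connectedComponentIn_cell [FiniteDimensional ℝ E] {W : Submodule ℝ E} {T : Set ι}
    {ν : ι → E →L[ℝ] ℝ}
    {x : E} (hx : x ∈ W ∧ ∀ i ∈ T, ν i x ≠ 0) :
    closure (connectedComponentIn {y | y ∈ W ∧ ∀ i ∈ T, ν i y ≠ 0} x) = cell W T ν x := by
  rw [connectedComponentIn_cell hx]
  apply Set.Subset.antisymm
  · apply closure_minimal
    · exact fun y hy => ⟨hy.1, fun i hi => (hy.2 i hi).le⟩
    · have : cell W T ν x = (W : Set E) ∩ ⋂ i ∈ T, {y | 0 ≤ ν i x * ν i y} := by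
        ext; simp [cell]
      rw [this]
      exact W.closed_of_finiteDimensional.inter (isClosed_biInter fun i _ =>
        isClosed_le continuous_const (by fun_prop))
  · intro y hy
    have hc : Filter.Tendsto (fun t : ℝ => y + t • x) (nhdsWithin 0 (Set.Ioi 0)) (nhds y) := by
      have : Filter.Tendsto (fun t : ℝ => y + t • x) (nhds 0) (nhds (y + (0 : ℝ) • x)) :=
        Continuous.tendsto (by fun_prop) 0
      simp only [zero_smul, add_zero] at this
      exact this.mono_left nhdsWithin_le_nhds
    refine mem_closure_of_tendsto hc ?_
    filter_upwards [self_mem_nhdsWithin] with t ht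
    refine ⟨W.add_mem hy.1 (W.smul_mem _ hx.1), fun i hi => ?_⟩
    have h1 := hy.2 i hi
    have h2 := mul_pos (show (0 : ℝ) < t from ht) (mul_self_pos.2 (hx.2 i hi))
    simp only [map_add, map_smul, smul_eq_mul]
    linarith

/-- The affine span contains both `0` and `x`, so from a relatively interior `y` one can step to `y
- t • x` without leaving the cell; this turns the weak inequalities into strict ones. -/
theorem intrinsicInterior_cell {W : Submodule ℝ E} {T : Set ι} (hT : T.Finite)
    {ν : ι → E →L[ℝ] ℝ} {x : E} (hx : x ∈ W ∧ ∀ i ∈ T, ν i x ≠ 0) :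
    intrinsicInterior ℝ (cell W T ν x) = {y | y ∈ W ∧ ∀ i ∈ T, 0 < ν i x * ν i y} := by
  apply Set.Subset.antisymm
  · rintro _ ⟨y, hy, rfl⟩
    have hyc : (y : E) ∈ cell W T ν x := Set.mem_preimage.1 (interior_subset hy)
    have h0 : (0 : E) ∈ affineSpan ℝ (cell W T ν x) :=
      subset_affineSpan ℝ _ ⟨W.zero_mem, by simp⟩
    have hxs : x ∈ affineSpan ℝ (cell W T ν x) := subset_affineSpan ℝ _ (self_mem_cell hx.1)
    have hmem : ∀ t : ℝ, t • (0 -ᵥ x) +ᵥ (y : E) ∈ affineSpan ℝ (cell W T ν x) := fun t =>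
      AffineSubspace.smul_vsub_vadd_mem _ t h0 hxs y.2
    let g : ℝ → affineSpan ℝ (cell W T ν x) := fun t => ⟨_, hmem t⟩
    have hg : Continuous g := by
      apply Continuous.subtype_mk
      simp only [vsub_eq_sub, vadd_eq_add]
      fun_prop
    have hg0 : g 0 = y := by ext; simp [g]
    have hev : ∀ᶠ t in nhdsWithin (0 : ℝ) (Set.Ioi 0), (g t : E) ∈ cell W T ν x := by
      have : Filter.Tendsto g (nhdsWithin 0 (Set.Ioi 0)) (nhds y) := by
        rw [← hg0]; exact (hg.tendsto 0).mono_left nhdsWithin_le_nhds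
      exact this (mem_interior_iff_mem_nhds.1 hy)
    obtain ⟨t, ht, ht0⟩ := (hev.and self_mem_nhdsWithin).exists
    refine ⟨hyc.1, fun i hi => ?_⟩
    have h1 : 0 ≤ ν i x * ν i (t • (0 -ᵥ x) +ᵥ (y : E)) := ht.2 i hi
    have h2 := mul_pos (show (0 : ℝ) < t from ht0) (mul_self_pos.2 (hx.2 i hi))
    simp at h1
    linarith
  · intro y hy
    have hyc : y ∈ cell W T ν x := ⟨hy.1, fun i hi => (hy.2 i hi).le⟩
    have hle : affineSpan ℝ (cell W T ν x) ≤ W.toAffineSubspace :=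
      affineSpan_le.2 fun z hz => hz.1
    refine ⟨⟨y, subset_affineSpan ℝ _ hyc⟩, ?_, rfl⟩
    rw [mem_interior]
    refine ⟨{z | ∀ i ∈ T, 0 < ν i x * ν i z}, fun z hz => ⟨hle z.2, fun i hi => (hz i hi).le⟩,
      ?_, hy.2⟩
    have : {z : affineSpan ℝ (cell W T ν x) | ∀ i ∈ T, 0 < ν i x * ν i z} =
        ⋂ i ∈ T, {z : affineSpan ℝ (cell W T ν x) | 0 < ν i x * ν i z} := by
      ext; simp
    rw [this]
    exact hT.isOpen_biInter fun i _ => isOpen_lt continuous_const (by fun_prop)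

end Cells

/-- Around `x` the cell contains a small step in every direction of `W`, so its affine hull is all
of `W`. -/
theorem hasCodim_of_cell_subset {d k : ℕ} {ι : Type*} {W : Submodule ℝ (EuclideanSpace ℝ (Fin d))}
    (hW : Module.finrank ℝ W + k = d) {T : Set ι} (hT : T.Finite)
    {ν : ι → EuclideanSpace ℝ (Fin d) →L[ℝ] ℝ} {x : EuclideanSpace ℝ (Fin d)}
    (hx : x ∈ W ∧ ∀ i ∈ T, ν i x ≠ 0) {S : Set (EuclideanSpace ℝ (Fin d))}
    (h1 : cell W T ν x ⊆ S) (h2 : S ⊆ W) : HasCodim S k := by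
  refine ⟨⟨x, h1 (self_mem_cell hx.1)⟩, ?_⟩
  suffices (affineSpan ℝ S).direction = W by rw [this, hW]
  apply le_antisymm
  · have : affineSpan ℝ S ≤ W.toAffineSubspace := affineSpan_le.2 h2
    simpa using AffineSubspace.direction_le this
  · intro w hw
    obtain ⟨ε, hε, hε'⟩ := exists_pos_forall_add_mul_pos hT (fun i => ν i x * ν i x)
        (fun i => ν i x * ν i w)
    have hm : x + ε • w ∈ S := by
      refine h1 ⟨W.add_mem hx.1 (W.smul_mem _ hw), fun i hi => ?_⟩
      have := hε' i hi (mul_self_pos.2 (hx.2 i hi))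
      simp only [map_add, map_smul, smul_eq_mul]
      linarith
    have hd := AffineSubspace.vsub_mem_direction (subset_affineSpan ℝ S hm)
      (subset_affineSpan ℝ S (h1 (self_mem_cell hx.1)))
    have := (affineSpan ℝ S).direction.smul_mem ε⁻¹ hd
    simpa [smul_smul, hε.ne'] using this

theorem HasCodim.exists_ne_zero {d k : ℕ} {S : Set (EuclideanSpace ℝ (Fin d))} (hS : HasCodim S k)
    {W : Submodule ℝ (EuclideanSpace ℝ (Fin d))} (hW : Module.finrank ℝ W + k = d)
    (hSW : S ⊆ W) (g : EuclideanSpace ℝ (Fin d) →L[ℝ] ℝ) (hg : ∃ w ∈ W, g w ≠ 0) :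
    ∃ y ∈ S, g y ≠ 0 := by
  by_contra! hcon
  have h1 : affineSpan ℝ S ≤
      (W ⊓ LinearMap.ker (g : EuclideanSpace ℝ (Fin d) →ₗ[ℝ] ℝ)).toAffineSubspace :=
    affineSpan_le.2 fun y hy => ⟨hSW hy, hcon y hy⟩
  have h2 := AffineSubspace.direction_le h1
  rw [Submodule.toAffineSubspace_direction] at h2
  have h3 := Submodule.finrank_mono h2
  have h4 : W ⊓ LinearMap.ker (g : EuclideanSpace ℝ (Fin d) →ₗ[ℝ] ℝ) < W := by
    refine lt_of_le_of_ne inf_le_left fun h => ?_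
    obtain ⟨w, hw, hgw⟩ := hg
    rw [← h] at hw
    exact hgw hw.2
  have h5 := Submodule.finrank_lt_finrank_of_lt h4
  have h6 := hS.2
  omega

/-! ### Simplicial families of functionals -/

section Simplicial

variable {E : Type*} [NormedAddCommGroup E] [NormedSpace ℝ E] {ι : Type*}

/-- Every chamber of the functionals `ν i`, `i ∈ T`, is a product of a simplicial cone with a
linear subspace: a basis `s` refines its rays, and each vector `s j` is either in the lineality
space or opposite to a wall. -/
def SimplicialOn (T : Set ι) (ν : ι → E →L[ℝ] ℝ) : Prop :=
  ∀ x, (∀ i ∈ T, ν i x ≠ 0) → ∃ (m : ℕ) (s : Module.Basis (Fin m) ℝ E),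
    (∀ i ∈ T, ∀ j, 0 ≤ ν i x * ν i (s j)) ∧
    ∀ j, (∀ i ∈ T, ν i (s j) = 0) ∨ ∃ i ∈ T, ∀ k ≠ j, ν i (s k) = 0

theorem apply_eq_sum_repr {m : ℕ} (s : Module.Basis (Fin m) ℝ E) (f : E →L[ℝ] ℝ) (y : E) :
    f y = ∑ j, s.repr y j * f (s j) := by
  calc f y = f (∑ j, s.repr y j • s j) := by rw [s.sum_repr]
    _ = _ := by simp only [map_sum, map_smul, smul_eq_mul]

theorem apply_eq_repr_mul {m : ℕ} (s : Module.Basis (Fin m) ℝ E) (f : E →L[ℝ] ℝ) (y : E)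
    {j : Fin m} (h : ∀ k ≠ j, f (s k) = 0) : f y = s.repr y j * f (s j) := by
  rw [apply_eq_sum_repr s f y]
  exact Finset.sum_eq_single j (fun k _ hk => by simp [h k hk]) (by simp)

/-- Restricting a simplicial family to the functionals vanishing at `z` leaves it simplicial. -/
theorem SimplicialOn.localize {T : Set ι} (hT : T.Finite) {ν : ι → E →L[ℝ] ℝ}
    (h : SimplicialOn T ν) (z : E) : SimplicialOn {i ∈ T | ν i z = 0} ν := by
  intro x hx
  -- The point `z + ε • x` lies in a chamber of the full family that has `z` in its closure; the
  -- basis of that chamber also serves the local one.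
  obtain ⟨ε, hε, hε'⟩ := exists_pos_forall_add_mul_pos hT (fun i => ν i z * ν i z)
    (fun i => ν i z * ν i x)
  have hpos : ∀ i ∈ T, ν i z ≠ 0 → 0 < ν i z * ν i (z + ε • x) := fun i hi h0 => by
    have := hε' i hi (mul_self_pos.2 h0)
    simp only [map_add, map_smul, smul_eq_mul]
    linarith
  have hloc : ∀ i, ν i z = 0 → ν i (z + ε • x) = ε * ν i x := fun i h0 => by simp [h0]
  have hgen : ∀ i ∈ T, ν i (z + ε • x) ≠ 0 := by
    intro i hi
    by_cases h0 : ν i z = 0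
    · rw [hloc i h0]; exact mul_ne_zero hε.ne' (hx i ⟨hi, h0⟩)
    · exact right_ne_zero_of_mul (hpos i hi h0).ne'
  have hnn : ∀ i ∈ T, 0 ≤ ν i z * ν i (z + ε • x) := by
    intro i hi
    by_cases h0 : ν i z = 0
    · simp [h0]
    · exact (hpos i hi h0).le
  obtain ⟨m, s, hs, hw⟩ := h _ hgen
  have hs' : ∀ i ∈ T, ν i z = 0 → ∀ j, 0 ≤ ν i x * ν i (s j) := by
    intro i hi h0 j
    have := hs i hi j
    rw [hloc i h0, mul_assoc] at this
    exact nonneg_of_mul_nonneg_right this hε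
  refine ⟨m, s, fun i hi => hs' i hi.1 hi.2, fun j => ?_⟩
  by_cases hj : ∀ i ∈ {i ∈ T | ν i z = 0}, ν i (s j) = 0
  · exact Or.inl hj
  push Not at hj
  obtain ⟨a, ⟨haT, haz⟩, ha⟩ := hj
  -- the coordinates of `z` are nonnegative on the non-degenerate part of the basis
  have hcoord : ∀ k, ν a (s k) ≠ 0 → 0 ≤ s.repr z k ∧
      (s.repr z k = 0 → ∃ i ∈ {i ∈ T | ν i z = 0}, ∀ l ≠ k, ν i (s l) = 0) := by
    intro k hk
    rcases hw k with h0 | ⟨i, hi, hik⟩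
    · exact absurd (h0 a haT) hk
    · have e1 := apply_eq_repr_mul s (ν i) z hik
      have e2 : 0 < ν i (z + ε • x) * ν i (s k) := by
        refine lt_of_le_of_ne (hs i hi k) fun h0 => ?_
        have h1 := (mul_eq_zero.1 h0.symm).resolve_left (hgen i hi)
        have := apply_eq_repr_mul s (ν i) (z + ε • x) hik
        rw [h1, mul_zero] at this
        exact hgen i hi this
      refine ⟨?_, fun h0 => ⟨i, ⟨hi, by rw [e1, h0, zero_mul]⟩, hik⟩⟩
      have e3 := hnn i hi
      rw [e1] at e3
      have e4 : 0 ≤ s.repr z k * (ν i (z + ε • x) * ν i (s k)) := by linarith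
      exact nonneg_of_mul_nonneg_left e4 e2
  right
  refine (hcoord j ha).2 ?_
  -- A zero sum of nonnegative terms forces the `j`-th coordinate of `z` to vanish, so the wall
  -- opposite `s j` passes through `z`.
  have hsum : ∑ k, s.repr z k * (ν a x * ν a (s k)) = 0 := by
    have := apply_eq_sum_repr s (ν a) z
    rw [haz] at this
    have h2 : ν a x * ∑ k, s.repr z k * ν a (s k) = 0 := by rw [← this, mul_zero]
    rw [Finset.mul_sum] at h2
    rw [← h2]
    exact Finset.sum_congr rfl fun k _ => by ring
  have hterm : ∀ k ∈ Finset.univ, 0 ≤ s.repr z k * (ν a x * ν a (s k)) := by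
    intro k _
    by_cases hk : ν a (s k) = 0
    · simp [hk]
    · exact mul_nonneg (hcoord k hk).1 (hs' a haT haz k)
  have := (Finset.sum_eq_zero_iff_of_nonneg hterm).1 hsum j (Finset.mem_univ _)
  exact (mul_eq_zero.1 this).resolve_right (mul_ne_zero (hx a ⟨haT, haz⟩) ha)

/-- If `p` lies on the hyperplane of `a` and otherwise strictly on the side of `x`, then the
hyperplane of `a` is a wall of the chamber of `x`. -/
theorem exists_wall {T : Set ι} {ν : ι → E →L[ℝ] ℝ} {x p : E} {m : ℕ}
    {s : Module.Basis (Fin m) ℝ E} (hx : ∀ i ∈ T, ν i x ≠ 0)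
    (hs : ∀ i ∈ T, ∀ j, 0 ≤ ν i x * ν i (s j))
    (hw : ∀ j, (∀ i ∈ T, ν i (s j) = 0) ∨ ∃ i ∈ T, ∀ k ≠ j, ν i (s k) = 0)
    {a : ι} (ha : a ∈ T) (hap : ν a p = 0) (hp : ∀ i ∈ T, i ≠ a → 0 < ν i x * ν i p) :
    ∃ j, ∀ k ≠ j, ν a (s k) = 0 := by
  by_contra! hcon
  -- If `a` is not a wall, every wall is strictly positive at `p` relative to `x`. Then `ν a p = 0`
  -- is a sum of terms of one sign, which makes `ν a` vanish identically.
  have hpos : ∀ j, ν a (s j) ≠ 0 → 0 < s.repr p j := by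
    intro j hj
    rcases hw j with h0 | ⟨i, hi, hij⟩
    · exact absurd (h0 a ha) hj
    · have hia : i ≠ a := by
        rintro rfl
        obtain ⟨k, hk, hk'⟩ := hcon j
        exact hk' (hij k hk)
      have h1 := hp i hi hia
      have h2 := hs i hi j
      rw [apply_eq_repr_mul s (ν i) p hij] at h1
      have h3 : 0 < s.repr p j * (ν i x * ν i (s j)) := by linarith
      exact pos_of_mul_pos_left h3 h2
  have hterm : ∀ j ∈ Finset.univ, 0 ≤ s.repr p j * (ν a x * ν a (s j)) := by
    intro j _
    by_cases hj : ν a (s j) = 0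
    · simp [hj]
    · exact mul_nonneg (hpos j hj).le (hs a ha j)
  have hsum : ∑ k, s.repr p k * (ν a x * ν a (s k)) = 0 := by
    have := apply_eq_sum_repr s (ν a) p
    rw [hap] at this
    have h2 : ν a x * ∑ k, s.repr p k * ν a (s k) = 0 := by rw [← this, mul_zero]
    rw [Finset.mul_sum] at h2
    rw [← h2]
    exact Finset.sum_congr rfl fun k _ => by ring
  have hz := (Finset.sum_eq_zero_iff_of_nonneg hterm).1 hsum
  have hall : ∀ j, ν a (s j) = 0 := by
    intro j
    by_contra hj
    exact mul_ne_zero (hpos j hj).ne' (mul_ne_zero (hx a ha) hj) (hz j (Finset.mem_univ _))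
  refine hx a ha ?_
  rw [apply_eq_sum_repr s (ν a) x]
  simp [hall]

/-- In a simplicial family of functionals that are positive at `b`, a functional that is not a
positive combination of two others is a wall of the chamber of `b`. -/
theorem SimplicialOn.exists_facet_point {T : Set ι} (hT : T.Finite) {ν : ι → E →L[ℝ] ℝ}
    (h : SimplicialOn T ν) {b : E} (hb : ∀ i ∈ T, 0 < ν i b)
    (hker : ∀ i ∈ T, ∀ j ∈ T, i ≠ j → ∃ y, ν i y = 0 ∧ ν j y ≠ 0) {a : ι} (ha : a ∈ T)
    (hext : ∀ i ∈ T, ∀ j ∈ T, i ≠ a → j ≠ a → ∀ c e : ℝ, 0 < c → 0 < e →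
      ν a ≠ c • ν i + e • ν j) :
    ∃ p, ν a p = 0 ∧ ∀ i ∈ T, i ≠ a → 0 < ν i p := by
  classical
  have hstart : ∃ p, ν a p = 0 ∧ ∀ i ∈ T, i ≠ a → ν i p ≠ 0 := by
    obtain ⟨p, hp, hp'⟩ := exists_mem_forall_ne_zero (C := {y | ν a y = 0})
      (fun x hx y hy ε _ => by simp_all) ⟨0, by simp⟩ (hT.subset (Set.sep_subset T (· ≠ a))) ν
      (fun i hi => by simpa using hker a ha i hi.1 (Ne.symm hi.2))
    exact ⟨p, hp, fun i hi hia => hp' i ⟨hi, hia⟩⟩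
  by_contra hno
  -- the number of functionals negative at `p` can always be decreased
  have hstep : ∀ p, ν a p = 0 → (∀ i ∈ T, i ≠ a → ν i p ≠ 0) →
      ∃ p', ν a p' = 0 ∧ (∀ i ∈ T, i ≠ a → ν i p' ≠ 0) ∧
        {i ∈ T | ν i p' < 0}.ncard < {i ∈ T | ν i p < 0}.ncard := by
    intro p hap hp
    obtain ⟨ε, hε, hε'⟩ := exists_pos_forall_add_mul_pos hT (fun i => ν i p * ν i p)
      (fun i => ν i p * ν i b)
    -- The chamber touching `p` on the side of `b`; it has `a` as a wall.
    set x := p + ε • b with hxdef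
    have hxa : 0 < ν a x := by simp [hxdef, hap]; exact mul_pos hε (hb a ha)
    have hxp : ∀ i ∈ T, i ≠ a → 0 < ν i x * ν i p := fun i hi hia => by
      have := hε' i hi (mul_self_pos.2 (hp i hi hia))
      simp only [hxdef, map_add, map_smul, smul_eq_mul]
      linarith
    have hx : ∀ i ∈ T, ν i x ≠ 0 := by
      intro i hi
      by_cases hia : i = a
      · rw [hia]; exact hxa.ne'
      · exact left_ne_zero_of_mul (hxp i hi hia).ne'
    obtain ⟨m, s, hs, hw⟩ := h x hx
    obtain ⟨j₀, hj₀⟩ := exists_wall hx hs hw ha hap hxp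
    -- If all walls were positive at `x`, this would be the chamber of `b`, and `p` would be the
    -- facet point excluded by `hno`.
    have hneg : ∃ j, ∃ i ∈ T, (∀ k ≠ j, ν i (s k) = 0) ∧ ν i x < 0 := by
      by_contra! hcon
      apply hno
      refine ⟨p, hap, fun n hn hna => ?_⟩
      have hbn : 0 < ν n x := by
        have h1 : 0 ≤ ν n x * ν n b := by
          rw [apply_eq_sum_repr s (ν n) b, Finset.mul_sum]
          refine Finset.sum_nonneg fun j _ => ?_
          rcases hw j with h0 | ⟨i, hi, hij⟩
          · simp [h0 n hn]
          · have h2 := lt_of_le_of_ne (hcon j i hi hij) (hx i hi).symm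
            have h3 := nonneg_of_mul_nonneg_right (hs i hi j) h2
            have h4 := hb i hi
            rw [apply_eq_repr_mul s (ν i) b hij] at h4
            have h5 := pos_of_mul_pos_left h4 h3
            have := mul_nonneg h5.le (hs n hn j)
            linarith
        exact lt_of_le_of_ne (nonneg_of_mul_nonneg_left h1 (hb n hn)) (hx n hn).symm
      exact pos_of_mul_pos_right (hxp n hn hna) hbn.le
    obtain ⟨j₁, e, he, hj₁, hex⟩ := hneg
    have hea : e ≠ a := by rintro rfl; linarith
    have hep : ν e p < 0 := by
      by_contra! h0
      exact absurd (hxp e he hea) (not_lt.2 (mul_nonpos_of_nonpos_of_nonneg hex.le h0))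
    have hej₁ : ν e (s j₁) ≠ 0 := by
      intro h0
      have := apply_eq_repr_mul s (ν e) x hj₁
      rw [h0, mul_zero] at this
      exact hx e he this
    have haj₀ : ν a (s j₀) ≠ 0 := by
      intro h0
      have := apply_eq_repr_mul s (ν a) x hj₀
      rw [h0, mul_zero] at this
      exact hx a ha this
    -- a point in the relative interior of the face cut out by `a` and `e`
    set f := ∑ j ∈ Finset.univ.filter (fun j => j ≠ j₀ ∧ j ≠ j₁), s j with hf
    have hfs : ∀ i, ν i f = ∑ j ∈ Finset.univ.filter (fun j => j ≠ j₀ ∧ j ≠ j₁), ν i (s j) :=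
      fun i => by simp [hf]
    have haf : ν a f = 0 := by
      rw [hfs]; exact Finset.sum_eq_zero fun j hj => hj₀ j (Finset.mem_filter.1 hj).2.1
    have hfnn : ∀ i ∈ T, 0 ≤ ν i x * ν i f := fun i hi => by
      rw [hfs, Finset.mul_sum]; exact Finset.sum_nonneg fun j _ => hs i hi j
    have hfz : ∀ i ∈ T, ν i f = 0 → ∀ j, j ≠ j₀ → j ≠ j₁ → ν i (s j) = 0 := by
      intro i hi h0 j h1 h2
      have h3 : ∑ j ∈ Finset.univ.filter (fun j => j ≠ j₀ ∧ j ≠ j₁), ν i x * ν i (s j) = 0 := by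
        rw [← Finset.mul_sum, ← hfs, h0, mul_zero]
      have := (Finset.sum_eq_zero_iff_of_nonneg fun j _ => hs i hi j).1 h3 j (by simp [h1, h2])
      exact (mul_eq_zero.1 this).resolve_left (hx i hi)
    -- The new point `f - η • p` is across the face from `p`, still on `a`: functionals nonzero at
    -- `f` keep their sign at `p`, those vanishing at `f` flip.
    obtain ⟨η, hη, hη'⟩ := exists_pos_forall_add_mul_pos hT (fun i => ν i f * ν i f)
      (fun i => ν i f * ν i (-p))
    have hp'off : ∀ i ∈ T, ν i f ≠ 0 → 0 < ν i p * ν i (f + η • -p) := by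
      intro i hi h0
      have hia : i ≠ a := fun h => h0 (h ▸ haf)
      have h1 := hη' i hi (mul_self_pos.2 h0)
      have h2 : 0 < ν i f * ν i (f + η • -p) := by
        simp only [map_add, map_smul, smul_eq_mul]; linarith
      have h3 := lt_of_le_of_ne (hfnn i hi) (mul_ne_zero (hx i hi) h0).symm
      have h4 := hxp i hi hia
      have h5 : 0 < (ν i p * ν i (f + η • -p)) * (ν i x * ν i f) := by
        have := mul_pos h2 h4; linarith
      exact pos_of_mul_pos_left h5 h3.le
    have hp'on : ∀ i, ν i f = 0 → ν i (f + η • -p) = - (η * ν i p) := fun i h0 => by simp [h0]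
    -- No flip goes from positive to negative: such a `ν i` would be `c • ν a + t • ν e` with `t <
    -- 0`, hence `c > 0` by evaluation at `b`, and solving for `ν a` contradicts `hext`. The flip of
    -- `e` makes the count drop strictly.
    have hspan : ∀ i ∈ T, ν i f = 0 → i ≠ a → ν i p < 0 := by
      intro i hi h0 hia
      by_contra! h1
      have h1 := lt_of_le_of_ne h1 (hp i hi hia).symm
      by_cases hj : j₀ = j₁
      · subst hj
        obtain ⟨y, hy, hy'⟩ := hker a ha e he hea.symm
        rw [apply_eq_repr_mul s (ν a) y hj₀] at hy
        rw [apply_eq_repr_mul s (ν e) y hj₁] at hy'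
        exact hy' (by rw [(mul_eq_zero.1 hy).resolve_right haj₀, zero_mul])
      have hexp : ∀ y, ν i y = ν i (s j₀) / ν a (s j₀) * ν a y +
          ν i (s j₁) / ν e (s j₁) * ν e y := by
        intro y
        rw [apply_eq_repr_mul s (ν a) y hj₀, apply_eq_repr_mul s (ν e) y hj₁,
          apply_eq_sum_repr s (ν i) y, ← Finset.sum_subset (Finset.subset_univ {j₀, j₁}),
          Finset.sum_pair hj]
        · field_simp
        · intro k _ hk
          simp only [Finset.mem_insert, Finset.mem_singleton, not_or] at hk
          rw [hfz i hi h0 k hk.1 hk.2, mul_zero]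
      set c := ν i (s j₀) / ν a (s j₀)
      set t := ν i (s j₁) / ν e (s j₁)
      have ht : t < 0 := by
        have := hexp p
        rw [hap, mul_zero, zero_add] at this
        rw [this] at h1
        by_contra! h2
        exact absurd h1 (not_lt.2 (mul_nonpos_of_nonneg_of_nonpos h2 hep.le))
      have hc : 0 < c := by
        have h2 := hexp b
        have h3 := hb i hi
        have h4 := mul_neg_of_neg_of_pos ht (hb e he)
        have h5 : 0 < c * ν a b := by linarith
        exact pos_of_mul_pos_left h5 (hb a ha).le
      refine hext i hi e he hia hea c⁻¹ (-t / c) (by positivity) (div_pos (neg_pos.2 ht) hc) ?_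
      ext y
      simp only [add_apply, smul_apply, smul_eq_mul]
      rw [hexp y]
      field_simp
      ring
    have hef : ν e f = 0 := by
      rw [hfs]; exact Finset.sum_eq_zero fun j hj => hj₁ j (Finset.mem_filter.1 hj).2.2
    refine ⟨f + η • -p, by simp [haf, hap], fun i hi hia => ?_, ?_⟩
    · by_cases h0 : ν i f = 0
      · rw [hp'on i h0]; exact neg_ne_zero.2 (mul_ne_zero hη.ne' (hp i hi hia))
      · exact right_ne_zero_of_mul (hp'off i hi h0).ne'
    · apply Set.ncard_lt_ncard _ (hT.subset (Set.sep_subset _ _))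
      refine ⟨fun i ⟨hi, hneg⟩ => ⟨hi, ?_⟩, fun hsub => ?_⟩
      · by_cases h0 : ν i f = 0
        · by_cases hia : i = a
          · rw [hia] at hneg; simp [haf, hap] at hneg
          · exact hspan i hi h0 hia
        · exact neg_of_mul_pos_left (hp'off i hi h0) hneg.le
      · have := (hsub ⟨he, hep⟩ : e ∈ T ∧ ν e (f + η • -p) < 0).2
        rw [hp'on e hef] at this
        have := mul_neg_of_pos_of_neg hη hep
        linarith
  have hind : ∀ n : ℕ, ∀ p, ν a p = 0 → (∀ i ∈ T, i ≠ a → ν i p ≠ 0) →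
      {i ∈ T | ν i p < 0}.ncard ≠ n := by
    intro n
    induction n using Nat.strong_induction_on with
    | _ n ih =>
      rintro p hap hp rfl
      obtain ⟨p', h1, h2, h3⟩ := hstep p hap hp
      exact ih _ h3 p' h1 h2 rfl
  obtain ⟨p, hap, hp⟩ := hstart
  exact hind _ p hap hp rfl

/-- The functionals of two walls of the chamber of `b` span a face of the cone of functionals. -/
theorem SimplicialOn.apply_eq_zero_of_add {T : Set ι} {ν : ι → E →L[ℝ] ℝ}
    (h : SimplicialOn T ν) {b : E} (hb : ∀ i ∈ T, 0 < ν i b) {a₁ a₂ : ι} (h₁ : a₁ ∈ T)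
    (h₂ : a₂ ∈ T) (hp₁ : ∃ p, ν a₁ p = 0 ∧ ∀ i ∈ T, i ≠ a₁ → 0 < ν i p)
    (hp₂ : ∃ p, ν a₂ p = 0 ∧ ∀ i ∈ T, i ≠ a₂ → 0 < ν i p) {c₁ c₂ e₁ e₂ : ℝ} {k l : ι}
    (hk : k ∈ T) (hl : l ∈ T) (he₁ : 0 < e₁) (he₂ : 0 < e₂)
    (heq : c₁ • ν a₁ + c₂ • ν a₂ = e₁ • ν k + e₂ • ν l) {y : E} (hy₁ : ν a₁ y = 0)
    (hy₂ : ν a₂ y = 0) : ν k y = 0 := by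
  classical
  have hb' : ∀ i ∈ T, ν i b ≠ 0 := fun i hi => (hb i hi).ne'
  obtain ⟨m, s, hs, hw⟩ := h b hb'
  obtain ⟨p₁, hz₁, hp₁⟩ := hp₁
  obtain ⟨p₂, hz₂, hp₂⟩ := hp₂
  obtain ⟨j₁, hj₁⟩ := exists_wall hb' hs hw h₁ hz₁ fun i hi hia => mul_pos (hb i hi) (hp₁ i hi hia)
  obtain ⟨j₂, hj₂⟩ := exists_wall hb' hs hw h₂ hz₂ fun i hi hia => mul_pos (hb i hi) (hp₂ i hi hia)
  have hs' : ∀ i ∈ T, ∀ j, 0 ≤ ν i (s j) := fun i hi j =>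
    nonneg_of_mul_nonneg_right (hs i hi j) (hb i hi)
  have hcoord : ∀ {i j}, i ∈ T → (∀ k ≠ j, ν i (s k) = 0) → ν i y = 0 → s.repr y j = 0 := by
    intro i j hi hij hy
    rw [apply_eq_repr_mul s (ν i) y hij] at hy
    refine (mul_eq_zero.1 hy).resolve_right fun h0 => hb' i hi ?_
    rw [apply_eq_repr_mul s (ν i) b hij, h0, mul_zero]
  rw [apply_eq_sum_repr s (ν k) y]
  refine Finset.sum_eq_zero fun j _ => ?_
  by_cases hjj₁ : j = j₁
  · rw [hjj₁, hcoord h₁ hj₁ hy₁, zero_mul]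
  by_cases hjj₂ : j = j₂
  · rw [hjj₂, hcoord h₂ hj₂ hy₂, zero_mul]
  -- Away from the two walls the left side vanishes on `s j`, while the right side is a sum of
  -- nonnegative terms.
  have h3 := DFunLike.congr_fun heq (s j)
  simp only [add_apply, smul_apply, smul_eq_mul,
    hj₁ j hjj₁, hj₂ j hjj₂, mul_zero, add_zero] at h3
  have h4 := mul_nonneg he₁.le (hs' k hk j)
  have h5 := mul_nonneg he₂.le (hs' l hl j)
  have h6 : e₁ * ν k (s j) = 0 := by linarith
  rw [(mul_eq_zero.1 h6).resolve_left he₁.ne', mul_zero]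

end Simplicial

/-! ### Normal functionals of an arrangement -/

section Arrangement

variable {d : ℕ} {A : Set (Submodule ℝ (EuclideanSpace ℝ (Fin d)))}

/-- `ν H` is the linear functional with kernel `H` and value `1` at the point `b`. -/
def IsNormal (A : Set (Submodule ℝ (EuclideanSpace ℝ (Fin d))))
    (b : EuclideanSpace ℝ (Fin d))
    (ν : Submodule ℝ (EuclideanSpace ℝ (Fin d)) → EuclideanSpace ℝ (Fin d) →L[ℝ] ℝ) : Prop :=
  ∀ H ∈ A, (∀ y, ν H y = 0 ↔ y ∈ H) ∧ ν H b = 1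

theorem IsArrangement.exists_isNormal (hA : IsArrangement A) {b : EuclideanSpace ℝ (Fin d)}
    (hb : b ∈ complement A) : ∃ ν, IsNormal A b ν := by
  have h : ∀ H : Submodule ℝ (EuclideanSpace ℝ (Fin d)),
      ∃ f : EuclideanSpace ℝ (Fin d) →L[ℝ] ℝ, H ∈ A → (∀ y, f y = 0 ↔ y ∈ H) ∧ f b = 1 := by
    intro H
    by_cases hH : H ∈ A
    · obtain ⟨f, hf, hfH⟩ := Submodule.exists_le_ker_of_notMem (hb H hH)
      have hker : H = LinearMap.ker f := by
        refine Submodule.eq_of_le_of_finrank_le hfH ?_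
        have h1 : LinearMap.ker f < ⊤ := lt_of_le_of_ne le_top fun h => by
          have : b ∈ LinearMap.ker f := h ▸ Submodule.mem_top
          exact hf this
        have h2 := Submodule.finrank_lt_finrank_of_lt h1
        have h3 : Module.finrank ℝ H + 1 = d := hA.isHyperplane H hH
        have h4 : Module.finrank ℝ (⊤ : Submodule ℝ (EuclideanSpace ℝ (Fin d))) = d := by simp
        omega
      refine ⟨(f b)⁻¹ • LinearMap.toContinuousLinearMap f, fun _ => ⟨fun y => ?_, ?_⟩⟩
      · conv_rhs => rw [hker]
        simp [hf]
      · simp [hf]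
    · exact ⟨0, fun h => absurd h hH⟩
  choose ν hν using h
  exact ⟨ν, hν⟩

variable {b : EuclideanSpace ℝ (Fin d)}
  {ν : Submodule ℝ (EuclideanSpace ℝ (Fin d)) → EuclideanSpace ℝ (Fin d) →L[ℝ] ℝ}

theorem IsNormal.mono (hν : IsNormal A b ν) {A' : Set (Submodule ℝ (EuclideanSpace ℝ (Fin d)))}
    (h : A' ⊆ A) : IsNormal A' b ν := fun H hH => hν H (h hH)

theorem IsNormal.ne_zero_iff (hν : IsNormal A b ν) {H : Submodule ℝ (EuclideanSpace ℝ (Fin d))}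
    (hH : H ∈ A) (y : EuclideanSpace ℝ (Fin d)) : ν H y ≠ 0 ↔ y ∉ H :=
  not_congr ((hν H hH).1 y)

theorem IsNormal.injOn (hν : IsNormal A b ν) : Set.InjOn ν A := by
  intro H hH K hK h
  ext y
  rw [← (hν H hH).1, ← (hν K hK).1, h]

theorem not_le_of_ne (hA : IsArrangement A) {H K : Submodule ℝ (EuclideanSpace ℝ (Fin d))}
    (hH : H ∈ A) (hK : K ∈ A) (hne : H ≠ K) : ∃ y ∈ H, y ∉ K := by
  by_contra! h
  refine hne (Submodule.eq_of_le_of_finrank_eq h ?_)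
  have h1 := hA.isHyperplane H hH
  have h2 := hA.isHyperplane K hK
  unfold IsHyperplane at h1 h2
  omega

theorem complement_eq (hν : IsNormal A b ν) :
    complement A = {y | y ∈ (⊤ : Submodule ℝ (EuclideanSpace ℝ (Fin d))) ∧ ∀ H ∈ A, ν H y ≠ 0} := by
  ext y
  simp only [complement, Set.mem_ofPred_eq, Submodule.mem_top, true_and]
  exact forall₂_congr fun H hH => (hν.ne_zero_iff hH y).symm

theorem closure_component_complement (hν : IsNormal A b ν) {x : EuclideanSpace ℝ (Fin d)}
    (hx : x ∈ complement A) :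
    closure (connectedComponentIn (complement A) x) = cell ⊤ A ν x := by
  rw [complement_eq hν] at hx ⊢
  exact closure_connectedComponentIn_cell hx

/-- A region has interior, so its independent generators form a basis. The sum `q` of all generators
but one is on the boundary, as otherwise `q - ε • t j` would be in the cone with a negative
coordinate. A hyperplane through `q` contains every generator in the sum. -/
theorem IsSimplicial.simplicialOn (hA : IsArrangement A) (hsimp : IsSimplicial A)
    (hν : IsNormal A b ν) : SimplicialOn A ν := by
  classical
  intro x hx
  have hxc : x ∈ complement A := fun H hH => (hν.ne_zero_iff hH x).1 (hx H hH)
  obtain ⟨s, hli, hs⟩ := hsimp _ ⟨x, hxc, rfl⟩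
  rw [closure_component_complement hν hxc] at hs
  have hspan : ⊤ ≤ Submodule.span ℝ (Set.range ((↑) : s → EuclideanSpace ℝ (Fin d))) := by
    rw [Subtype.range_coe]
    have hsub : cell ⊤ A ν x ⊆ Submodule.span ℝ s := by
      rw [hs]
      exact fun y hy => Submodule.span_subset_span _ ℝ s hy
    intro y _
    obtain ⟨ε, hε, hε'⟩ := exists_pos_forall_add_mul_pos hA.finite (fun i => ν i x * ν i x)
        (fun i => ν i x * ν i y)
    have hm : x + ε • y ∈ cell ⊤ A ν x := by
      refine ⟨Submodule.mem_top, fun i hi => ?_⟩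
      have := hε' i hi (mul_self_pos.2 (hx i hi))
      simp only [map_add, map_smul, smul_eq_mul]
      linarith
    have h1 := Submodule.sub_mem _ (hsub hm) (hsub (self_mem_cell Submodule.mem_top))
    have h2 := Submodule.smul_mem _ ε⁻¹ h1
    simpa [smul_smul, hε.ne'] using h2
  let e := Module.Basis.mk (v := ((↑) : s → EuclideanSpace ℝ (Fin d))) hli hspan
  have he : ∀ i : s, e i = i := Module.Basis.mk_apply _ hspan
  have : Fintype s := Module.Basis.fintypeIndexOfRankLtAleph0 e (Module.rank_lt_aleph0 ℝ _)
  let t := e.reindex (Fintype.equivFin s)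
  have hts : ∀ j, t j ∈ s := fun j => by simp [t, he]
  have htr : ∀ y ∈ cell ⊤ A ν x, ∀ j, 0 ≤ t.repr y j := by
    intro y hy j
    rw [hs] at hy
    induction hy using Submodule.span_induction with
    | mem y hy =>
      have : y = t (Fintype.equivFin s ⟨y, hy⟩) := by simp [t, he]
      rw [this, t.repr_self, Finsupp.single_apply]
      split_ifs <;> norm_num
    | zero => simp
    | add y z _ _ h1 h2 => simp only [map_add, Finsupp.add_apply]; linarith
    | smul c y _ h1 =>
      have : c • y = (c : ℝ) • y := rfl
      rw [this, map_smul, Finsupp.smul_apply, smul_eq_mul]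
      exact mul_nonneg c.2 h1
  have htc : ∀ j, t j ∈ cell ⊤ A ν x := fun j => by
    rw [hs]; exact PointedCone.subset_hull (hts j)
  refine ⟨_, t, fun i hi j => (htc j).2 i hi, fun j => Or.inr ?_⟩
  set q := ∑ k ∈ Finset.univ.erase j, t k with hq
  have hνq : ∀ i, ν i x * ν i q = ∑ k ∈ Finset.univ.erase j, ν i x * ν i (t k) := fun i => by
    rw [hq, map_sum, Finset.mul_sum]
  have hex : ∃ i ∈ A, ν i x * ν i q = 0 := by
    by_contra! hcon
    have hpos : ∀ i ∈ A, 0 < ν i x * ν i q := fun i hi => by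
      refine lt_of_le_of_ne ?_ (hcon i hi).symm
      rw [hνq]
      exact Finset.sum_nonneg fun k _ => (htc k).2 i hi
    obtain ⟨ε, hε, hε'⟩ := exists_pos_forall_add_mul_pos hA.finite (fun i => ν i x * ν i q)
        (fun i => ν i x * ν i (- t j))
    have hm : q + ε • (- t j) ∈ cell ⊤ A ν x := by
      refine ⟨Submodule.mem_top, fun i hi => ?_⟩
      have := hε' i hi (hpos i hi)
      simp only [map_add, map_smul, smul_eq_mul]
      linarith
    have h1 := htr _ hm j
    have h2 : t.repr q j = 0 := by
      rw [hq, map_sum, Finsupp.finsetSum_apply]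
      refine Finset.sum_eq_zero fun k hk => ?_
      rw [t.repr_self, Finsupp.single_apply, if_neg (Finset.ne_of_mem_erase hk)]
    simp [h2] at h1
    linarith
  obtain ⟨i, hi, h0⟩ := hex
  rw [hνq] at h0
  refine ⟨i, hi, fun k hk => ?_⟩
  have := (Finset.sum_eq_zero_iff_of_nonneg fun k _ => (htc k).2 i hi).1 h0 k
    (Finset.mem_erase.2 ⟨hk, Finset.mem_univ _⟩)
  exact (mul_eq_zero.1 this).resolve_left (hx i hi)

/-! ### Basic hyperplanes -/

theorem isBasic_iff (hA : IsArrangement A) (hν : IsNormal A b ν)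
    {A' : Set (Submodule ℝ (EuclideanSpace ℝ (Fin d)))} (hA' : A' ⊆ A)
    {H : Submodule ℝ (EuclideanSpace ℝ (Fin d))} :
    IsBasic A' (cell ⊤ A ν b) H ↔
      H ∈ A' ∧ ∃ p, ν H p = 0 ∧ ∀ L ∈ A', L ≠ H → 0 < ν L p := by
  have hν' := hν.mono hA'
  refine and_congr_right fun hH => ⟨?_, ?_⟩
  · rintro ⟨_, ⟨x, hx, rfl⟩, hB, hcod⟩
    rw [closure_component_complement hν' hx] at hB hcod
    have hbx := hB (self_mem_cell Submodule.mem_top)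
    have hxpos : ∀ L ∈ A', 0 < ν L x := fun L hL => by
      have := hbx.2 L hL
      rw [(hν' L hL).2, mul_one] at this
      exact lt_of_le_of_ne this ((hν'.ne_zero_iff hL x).2 (hx L hL)).symm
    obtain ⟨p, ⟨hpH, hpc⟩, hp⟩ := exists_mem_forall_ne_zero
      (C := (H : Set (EuclideanSpace ℝ (Fin d))) ∩ cell ⊤ A' ν x)
      (fun y hy z hz ε hε => ⟨H.add_mem hy.1 (H.smul_mem _ hz.1), add_smul_mem_cell hy.2 hz.2 hε⟩)
      hcod.1 ((hA.finite.subset hA').subset (Set.sep_subset A' (· ≠ H))) ν (fun L hL => by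
        refine hcod.exists_ne_zero (hA.isHyperplane H (hA' hH)) Set.inter_subset_left (ν L) ?_
        obtain ⟨y, hy, hy'⟩ := not_le_of_ne hA (hA' hH) (hA' hL.1) (Ne.symm hL.2)
        exact ⟨y, hy, (hν'.ne_zero_iff hL.1 y).2 hy'⟩)
    refine ⟨p, ((hν' H hH).1 p).2 hpH, fun L hL hne => ?_⟩
    exact lt_of_le_of_ne (nonneg_of_mul_nonneg_right (hpc.2 L hL) (hxpos L hL)) (hp L ⟨hL, hne⟩).symm
  · rintro ⟨p, hpH, hp⟩
    have hb : b ∈ complement A' := fun L hL h => by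
      have := ((hν' L hL).1 b).2 h
      rw [(hν' L hL).2] at this
      exact one_ne_zero this
    refine ⟨_, ⟨b, hb, rfl⟩, ?_, ?_⟩
    · rw [closure_component_complement hν' hb]
      exact fun y hy => ⟨hy.1, fun L hL => hy.2 L (hA' hL)⟩
    · rw [closure_component_complement hν' hb]
      refine hasCodim_of_cell_subset (hA.isHyperplane H (hA' hH))
        ((hA.finite.subset hA').subset (Set.sep_subset A' (· ≠ H))) (ν := ν) (x := p)
        ⟨((hν' H hH).1 p).1 hpH, fun L hL => (hp L hL.1 hL.2).ne'⟩ ?_ Set.inter_subset_left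
      intro y hy
      refine ⟨hy.1, Submodule.mem_top, fun L hL => ?_⟩
      rw [(hν' L hL).2, one_mul]
      by_cases hne : L = H
      · rw [hne, ((hν' H hH).1 y).2 hy.1]
      · exact nonneg_of_mul_nonneg_right (hy.2 L ⟨hL, hne⟩) (hp L hL hne)

theorem IsBasic.ne_add (hA : IsArrangement A) (hν : IsNormal A b ν)
    {A' : Set (Submodule ℝ (EuclideanSpace ℝ (Fin d)))} (hA' : A' ⊆ A)
    {H K L : Submodule ℝ (EuclideanSpace ℝ (Fin d))} (hH : IsBasic A' (cell ⊤ A ν b) H)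
    (hK : K ∈ A') (hL : L ∈ A') (hKH : K ≠ H) (hLH : L ≠ H) {c e : ℝ} (hc : 0 < c) (he : 0 < e) :
    ν H ≠ c • ν K + e • ν L := by
  intro h
  obtain ⟨_, p, hp, hp'⟩ := (isBasic_iff hA hν hA').1 hH
  have := DFunLike.congr_fun h p
  simp only [add_apply, smul_apply, smul_eq_mul, hp] at this
  have h1 := mul_pos hc (hp' K hK hKH)
  have h2 := mul_pos he (hp' L hL hLH)
  linarith

theorem rankTwo_subset (A : Set (Submodule ℝ (EuclideanSpace ℝ (Fin d))))
    (H K : Submodule ℝ (EuclideanSpace ℝ (Fin d))) : rankTwo A H K ⊆ A := fun _ h => h.1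

theorem rankTwo_eq (hA : IsArrangement A) {H₁ H₂ K₁ K₂ : Submodule ℝ (EuclideanSpace ℝ (Fin d))}
    (h₁ : H₁ ∈ A) (h₂ : H₂ ∈ A) (hne : H₁ ≠ H₂) (hK₁ : K₁ ∈ rankTwo A H₁ H₂)
    (hK₂ : K₂ ∈ rankTwo A H₁ H₂) (hK : K₁ ≠ K₂) : rankTwo A K₁ K₂ = rankTwo A H₁ H₂ :=
  (eq_rankTwo hA (isRankTwoSubarrangement_rankTwo hA h₁ h₂ hne) hK₁ hK₂ hK).symm

theorem left_mem_rankTwo {H K : Submodule ℝ (EuclideanSpace ℝ (Fin d))} (hH : H ∈ A) :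
    H ∈ rankTwo A H K := ⟨hH, inf_le_left⟩

theorem right_mem_rankTwo {H K : Submodule ℝ (EuclideanSpace ℝ (Fin d))} (hK : K ∈ A) :
    K ∈ rankTwo A H K := ⟨hK, inf_le_right⟩

/-- A rank-two subarrangement has exactly two basic hyperplanes, and the other normals are
positive combinations of the two basic ones. -/
theorem exists_basic_pair (hA : IsArrangement A) (hν : IsNormal A b ν)
    {H₁ H₂ : Submodule ℝ (EuclideanSpace ℝ (Fin d))} (h₁ : H₁ ∈ A) (h₂ : H₂ ∈ A)
    (hne : H₁ ≠ H₂) : ∃ K K', K ≠ K' ∧ IsBasic (rankTwo A H₁ H₂) (cell ⊤ A ν b) K ∧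
      IsBasic (rankTwo A H₁ H₂) (cell ⊤ A ν b) K' ∧ ∀ L ∈ rankTwo A H₁ H₂,
        L = K ∨ L = K' ∨ ∃ c e : ℝ, 0 < c ∧ 0 < e ∧ ν L = c • ν K + e • ν K' := by
  have hsub := rankTwo_subset A H₁ H₂
  have hν' := hν.mono hsub
  obtain ⟨y, hy, hy'⟩ := not_le_of_ne hA h₁ h₂ hne
  rw [← hν.ne_zero_iff h₂] at hy'
  set p := (ν H₂ y)⁻¹ • y with hp
  have hp₁ : ν H₁ p = 0 := by simp [hp, ((hν H₁ h₁).1 y).2 hy]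
  have hp₂ : ν H₂ p = 1 := by simp [hp, hy']
  -- Modulo `H₁ ⊓ H₂` the space is spanned by `b` and `p`, so a normal is determined by its value at
  -- `p`; the basic hyperplanes are those of least and greatest value.
  have hcoord : ∀ L ∈ rankTwo A H₁ H₂, ∀ y, ν L y = ν H₁ y + ν L p * (ν H₂ y - ν H₁ y) := by
    intro L hL y
    have hu : y - (ν H₁ y) • b - (ν H₂ y - ν H₁ y) • p ∈ H₁ ⊓ H₂ := by
      refine ⟨((hν H₁ h₁).1 _).1 ?_, ((hν H₂ h₂).1 _).1 ?_⟩
      · simp [hp₁, (hν H₁ h₁).2]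
      · simp [hp₂, (hν H₂ h₂).2]
    have := ((hν' L hL).1 _).2 (hL.2 hu)
    simp only [map_sub, map_smul, smul_eq_mul, (hν' L hL).2] at this
    linarith
  have hinj : ∀ L ∈ rankTwo A H₁ H₂, ∀ M ∈ rankTwo A H₁ H₂, ν L p = ν M p → L = M := by
    intro L hL M hM h
    refine hν'.injOn hL hM ?_
    ext y
    rw [hcoord L hL y, hcoord M hM y, h]
  have hfin : (rankTwo A H₁ H₂).Finite := hA.finite.subset hsub
  have hnonempty : (rankTwo A H₁ H₂).Nonempty := ⟨H₁, left_mem_rankTwo h₁⟩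
  obtain ⟨K, hK, hKmin⟩ := Set.exists_min_image _ (fun L => ν L p) hfin hnonempty
  obtain ⟨K', hK', hKmax⟩ := Set.exists_max_image _ (fun L => ν L p) hfin hnonempty
  refine ⟨K, K', ?_, (isBasic_iff hA hν hsub).2 ⟨hK, p - ν K p • b, ?_, fun L hL hLK => ?_⟩,
    (isBasic_iff hA hν hsub).2 ⟨hK', ν K' p • b - p, ?_, fun L hL hLK => ?_⟩, fun L hL => ?_⟩
  · rintro rfl
    have h3 := hKmin H₁ (left_mem_rankTwo h₁)
    have h4 := hKmax H₂ (right_mem_rankTwo h₂)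
    rw [hp₁] at h3
    rw [hp₂] at h4
    linarith
  · simp [(hν' K hK).2]
  · have := lt_of_le_of_ne (hKmin L hL) fun h => hLK (hinj _ hK _ hL h).symm
    simp [(hν' L hL).2, this]
  · simp [(hν' K' hK').2]
  · have := lt_of_le_of_ne (hKmax L hL) fun h => hLK (hinj _ hL _ hK' h)
    simp [(hν' L hL).2, this]
  · by_cases hLK : L = K
    · exact Or.inl hLK
    by_cases hLK' : L = K'
    · exact Or.inr (Or.inl hLK')
    have h3 := lt_of_le_of_ne (hKmin L hL) fun h => hLK (hinj _ hK _ hL h).symm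
    have h4 := lt_of_le_of_ne (hKmax L hL) fun h => hLK' (hinj _ hL _ hK' h)
    refine Or.inr (Or.inr ⟨(ν K' p - ν L p) / (ν K' p - ν K p), (ν L p - ν K p) / (ν K' p - ν K p),
      div_pos (sub_pos.2 h4) (sub_pos.2 (h3.trans h4)),
      div_pos (sub_pos.2 h3) (sub_pos.2 (h3.trans h4)), ?_⟩)
    have h5 : ν K' p - ν K p ≠ 0 := (sub_pos.2 (h3.trans h4)).ne'
    ext y
    simp only [add_apply, smul_apply, smul_eq_mul]
    rw [hcoord L hL y, hcoord K hK y, hcoord K' hK' y]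
    field_simp
    ring

/-! ### Shards -/

/-- The hyperplanes that cut `H`. -/
def cutters (A : Set (Submodule ℝ (EuclideanSpace ℝ (Fin d))))
    (B : Set (EuclideanSpace ℝ (Fin d))) (H : Submodule ℝ (EuclideanSpace ℝ (Fin d))) :
    Set (Submodule ℝ (EuclideanSpace ℝ (Fin d))) := {K | Cuts A B K H}

theorem cutters_subset (A : Set (Submodule ℝ (EuclideanSpace ℝ (Fin d))))
    (B : Set (EuclideanSpace ℝ (Fin d))) (H : Submodule ℝ (EuclideanSpace ℝ (Fin d))) :
    cutters A B H ⊆ A := fun _ hK => hK.1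

theorem uncut_eq (hν : IsNormal A b ν) (B : Set (EuclideanSpace ℝ (Fin d)))
    (H : Submodule ℝ (EuclideanSpace ℝ (Fin d))) :
    uncut A B H = {y | y ∈ H ∧ ∀ K ∈ cutters A B H, ν K y ≠ 0} := by
  ext y
  exact and_congr_right fun _ => forall₂_congr fun K hK => (hν.ne_zero_iff hK.1 y).symm

theorem Shard.carrier_eq_cell (hν : IsNormal A b ν) {B : Set (EuclideanSpace ℝ (Fin d))}
    (S : Shard A B) : ∃ x ∈ uncut A B S.hyperplane,
      S.carrier = cell S.hyperplane (cutters A B S.hyperplane) ν x := by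
  obtain ⟨x, hx, h⟩ := S.isComponent
  refine ⟨x, hx, h.trans ?_⟩
  rw [uncut_eq hν] at hx ⊢
  exact closure_connectedComponentIn_cell hx

theorem Shard.carrier_eq_cell_of_mem (hν : IsNormal A b ν) {B : Set (EuclideanSpace ℝ (Fin d))}
    (S : Shard A B) {x : EuclideanSpace ℝ (Fin d)} (hx : x ∈ S.carrier)
    (hx' : x ∈ uncut A B S.hyperplane) :
    S.carrier = cell S.hyperplane (cutters A B S.hyperplane) ν x := by
  obtain ⟨x₀, hx₀, h⟩ := S.carrier_eq_cell hν
  rw [uncut_eq hν] at hx₀ hx'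
  rw [h] at hx ⊢
  exact cell_eq_of_mem hx₀.2 hx hx'.2

theorem Shard.intrinsicInterior_carrier (hA : IsArrangement A) (hν : IsNormal A b ν)
    {B : Set (EuclideanSpace ℝ (Fin d))} (S : Shard A B) :
    intrinsicInterior ℝ S.carrier = S.carrier ∩ uncut A B S.hyperplane := by
  obtain ⟨x, hx, h⟩ := S.carrier_eq_cell hν
  rw [uncut_eq hν] at hx ⊢
  rw [h, intrinsicInterior_cell (hA.finite.subset (cutters_subset _ _ _)) hx]
  ext y
  constructor
  · exact fun hy => ⟨⟨hy.1, fun K hK => (hy.2 K hK).le⟩, hy.1,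
      fun K hK => right_ne_zero_of_mul (hy.2 K hK).ne'⟩
  · exact fun hy => ⟨hy.1.1, fun K hK => lt_of_le_of_ne (hy.1.2 K hK)
      (mul_ne_zero (hx.2 K hK) (hy.2.2 K hK)).symm⟩

theorem exists_shard {B : Set (EuclideanSpace ℝ (Fin d))}
    {H : Submodule ℝ (EuclideanSpace ℝ (Fin d))} (hH : H ∈ A) {x : EuclideanSpace ℝ (Fin d)}
    (hx : x ∈ uncut A B H) : ∃ S : Shard A B, S.hyperplane = H ∧ x ∈ S.carrier := by
  refine ⟨⟨H, _, hH, x, hx, rfl⟩, rfl, ?_⟩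
  exact subset_closure (mem_connectedComponentIn hx)

/-- Otherwise a basic hyperplane of the subarrangement would cut `H` and contain `x`. -/
theorem isBasic_of_mem_uncut (hA : IsArrangement A) (hν : IsNormal A b ν)
    {H L : Submodule ℝ (EuclideanSpace ℝ (Fin d))} (hH : H ∈ A) (hL : L ∈ A) (hne : H ≠ L)
    {x : EuclideanSpace ℝ (Fin d)} (hx : x ∈ uncut A (cell ⊤ A ν b) H) (hxL : x ∈ L) :
    IsBasic (rankTwo A H L) (cell ⊤ A ν b) H := by
  by_contra hnb
  obtain ⟨K, -, -, hK, -⟩ := exists_basic_pair hA hν hH hL hne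
  have hKH : K ≠ H := fun h => hnb (h ▸ hK)
  have hR := rankTwo_eq hA hH hL hne hK.1 (left_mem_rankTwo hH) hKH
  exact hx.2 K ⟨hK.1.1, hH, hKH, hR ▸ hK, hR ▸ hnb⟩ (hK.1.2 ⟨hx.1, hxL⟩)

/-- A hyperplane that is not cut near `z` is a wall, near `z`, of the region containing the base
region. -/
theorem exists_facet_point_of_mem_uncut (hA : IsArrangement A) (hsimp : IsSimplicial A)
    (hν : IsNormal A b ν) {H : Submodule ℝ (EuclideanSpace ℝ (Fin d))} (hH : H ∈ A)
    {z : EuclideanSpace ℝ (Fin d)} (hz : z ∈ uncut A (cell ⊤ A ν b) H) :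
    ∃ p, ν H p = 0 ∧ ∀ L ∈ {L ∈ A | ν L z = 0}, L ≠ H → 0 < ν L p := by
  have hfin : {L ∈ A | ν L z = 0}.Finite := hA.finite.subset (Set.sep_subset _ _)
  refine ((hsimp.simplicialOn hA hν).localize hA.finite z).exists_facet_point hfin (b := b)
    (fun L hL => by rw [(hν L hL.1).2]; norm_num) ?_ ⟨hH, ((hν H hH).1 z).2 hz.1⟩ ?_
  · intro L hL M hM hne
    obtain ⟨y, hy, hy'⟩ := not_le_of_ne hA hL.1 hM.1 hne
    exact ⟨y, ((hν L hL.1).1 y).2 hy, (hν.ne_zero_iff hM.1 y).2 hy'⟩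
  · intro L hL M hM hLH hMH c e hc he heq
    have hbas := isBasic_of_mem_uncut hA hν hH hL.1 hLH.symm hz (((hν L hL.1).1 z).1 hL.2)
    refine hbas.ne_add hA hν (rankTwo_subset _ _ _) (right_mem_rankTwo hL.1) ⟨hM.1, ?_⟩ hLH hMH
      hc he heq
    intro y hy
    have h1 := DFunLike.congr_fun heq y
    simp only [add_apply, smul_apply, smul_eq_mul, ((hν H hH).1 y).2 hy.1,
      ((hν L hL.1).1 y).2 hy.2, mul_zero, zero_add] at h1
    exact ((hν M hM.1).1 y).1 ((mul_eq_zero.1 h1.symm).resolve_left he.ne')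

/-- If neither of the two basic hyperplanes `H₁`, `H₁'` is cut near `z`, then a hyperplane `K`
through `z` that cuts a hyperplane `H₂` of their rank-two subarrangement belongs to that
subarrangement. -/
theorem inf_le_of_cuts (hA : IsArrangement A) (hsimp : IsSimplicial A) (hν : IsNormal A b ν)
    {H₁ H₁' H₂ K : Submodule ℝ (EuclideanSpace ℝ (Fin d))} (h₁ : H₁ ∈ A) (h₁' : H₁' ∈ A)
    {c₁ c₂ : ℝ} (h₂ : ν H₂ = c₁ • ν H₁ + c₂ • ν H₁') {z : EuclideanSpace ℝ (Fin d)}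
    (hz : z ∈ uncut A (cell ⊤ A ν b) H₁) (hz' : z ∈ uncut A (cell ⊤ A ν b) H₁')
    (hK : Cuts A (cell ⊤ A ν b) K H₂) (hzK : z ∈ K) : H₁ ⊓ H₁' ≤ K := by
  obtain ⟨hKA, h₂A, hne, hKb, h₂b⟩ := hK
  have hz₁ : ν H₁ z = 0 := ((hν H₁ h₁).1 z).2 hz.1
  have hz₁' : ν H₁' z = 0 := ((hν H₁' h₁').1 z).2 hz'.1
  have hz₂ : z ∈ H₂ := ((hν H₂ h₂A).1 z).1 (by rw [h₂]; simp [hz₁, hz₁'])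
  -- Being basic, `K` is one of the two basic hyperplanes; `L` is the other one.
  have hcomb : ∃ L ∈ {L ∈ A | ν L z = 0}, ∃ e₁ e₂ : ℝ, 0 < e₁ ∧ 0 < e₂ ∧
      ν H₂ = e₁ • ν K + e₂ • ν L := by
    have hmem : ∀ L ∈ rankTwo A K H₂, L ∈ {L ∈ A | ν L z = 0} := fun L hL =>
      ⟨hL.1, ((hν L hL.1).1 z).2 (hL.2 ⟨hzK, hz₂⟩)⟩
    obtain ⟨M, M', hMM', hM, hM', hall⟩ := exists_basic_pair hA hν hKA h₂A hne
    have hcomb₂ : ∃ c e : ℝ, 0 < c ∧ 0 < e ∧ ν H₂ = c • ν M + e • ν M' := by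
      rcases hall H₂ (right_mem_rankTwo h₂A) with h | h | h
      · exact absurd (h ▸ hM) h₂b
      · exact absurd (h ▸ hM') h₂b
      · exact h
    obtain ⟨c, e, hc, he, heq⟩ := hcomb₂
    by_cases hKM : K = M
    · exact ⟨M', hmem M' hM'.1, c, e, hc, he, hKM ▸ heq⟩
    by_cases hKM' : K = M'
    · exact ⟨M, hmem M hM.1, e, c, he, hc, by rw [heq, hKM', add_comm]⟩
    rcases hall K (left_mem_rankTwo hKA) with h | h | ⟨c', e', hc', he', heq'⟩
    · exact absurd h hKM
    · exact absurd h hKM'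
    · exact absurd heq' (hKb.ne_add hA hν (rankTwo_subset _ _ _) hM.1 hM'.1 (Ne.symm hKM)
        (Ne.symm hKM') hc' he')
  obtain ⟨L, hL, e₁, e₂, he₁, he₂, heq⟩ := hcomb
  intro y hy
  refine ((hν K hKA).1 y).1 ?_
  exact ((hsimp.simplicialOn hA hν).localize hA.finite z).apply_eq_zero_of_add (b := b)
    (fun L hL => by rw [(hν L hL.1).2]; norm_num) ⟨h₁, hz₁⟩ ⟨h₁', hz₁'⟩
    (exists_facet_point_of_mem_uncut hA hsimp hν h₁ hz)
    (exists_facet_point_of_mem_uncut hA hsimp hν h₁' hz') ⟨hKA, ((hν K hKA).1 z).2 hzK⟩ hL he₁ he₂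
    (h₂.symm.trans heq) (((hν H₁ h₁).1 y).2 hy.1) (((hν H₁' h₁').1 y).2 hy.2)

/-! ### The two implications -/

theorem exists_compatible_of_adj (hA : IsArrangement A) (hsimp : IsSimplicial A)
    (hν : IsNormal A b ν) (S₁ S₂ : Shard A (cell ⊤ A ν b))
    (h : (shardDigraph A (cell ⊤ A ν b)).Adj S₁ S₂) :
    ∃ S₁' : Shard A (cell ⊤ A ν b), S₁.Compatible S₁' ∧
      (S₁.hyperplane ≠ S₁'.hyperplane ∧
        S₂.hyperplane ∈ rankTwo A S₁.hyperplane S₁'.hyperplane ∧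
        ¬ IsBasic (rankTwo A S₁.hyperplane S₁'.hyperplane) (cell ⊤ A ν b) S₂.hyperplane) ∧
      S₁.carrier ∩ S₁'.carrier ⊆ S₂.carrier := by
  obtain ⟨⟨h₁, h₂, hne, hb₁, hb₂⟩, hcod⟩ := h
  set H₁ := S₁.hyperplane with hH₁
  set H₂ := S₂.hyperplane with hH₂
  -- the other basic hyperplane
  obtain ⟨H₁', hne', hb₁', c₁, c₂, hcomb⟩ : ∃ H₁', H₁ ≠ H₁' ∧
      IsBasic (rankTwo A H₁ H₂) (cell ⊤ A ν b) H₁' ∧ ∃ c₁ c₂ : ℝ,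
        ν H₂ = c₁ • ν H₁ + c₂ • ν H₁' := by
    obtain ⟨M, M', hMM', hM, hM', hall⟩ := exists_basic_pair hA hν h₁ h₂ hne
    have hcomb₂ : ∃ c e : ℝ, ν H₂ = c • ν M + e • ν M' := by
      rcases hall H₂ (right_mem_rankTwo h₂) with h | h | ⟨c, e, _, _, heq⟩
      · exact absurd (h ▸ hM) hb₂
      · exact absurd (h ▸ hM') hb₂
      · exact ⟨c, e, heq⟩
    obtain ⟨c, e, heq⟩ := hcomb₂
    by_cases hKM : H₁ = M
    · exact ⟨M', hKM ▸ hMM', hM', c, e, hKM ▸ heq⟩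
    by_cases hKM' : H₁ = M'
    · exact ⟨M, hKM, hM, e, c, by rw [heq, hKM', add_comm]⟩
    rcases hall H₁ (left_mem_rankTwo h₁) with h | h | ⟨c', e', hc', he', heq'⟩
    · exact absurd h hKM
    · exact absurd h hKM'
    · exact absurd heq' (hb₁.ne_add hA hν (rankTwo_subset _ _ _) hM.1 hM'.1 (Ne.symm hKM)
        (Ne.symm hKM') hc' he')
  have h₁' : H₁' ∈ A := hb₁'.1.1
  have hR : rankTwo A H₁ H₁' = rankTwo A H₁ H₂ :=
    rankTwo_eq hA h₁ h₂ hne (left_mem_rankTwo h₁) hb₁'.1 hne'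
  obtain ⟨x₁, hx₁, hS₁⟩ := S₁.carrier_eq_cell hν
  obtain ⟨x₂, hx₂, hS₂⟩ := S₂.carrier_eq_cell hν
  rw [← hH₁] at hx₁ hS₁
  rw [← hH₂] at hx₂ hS₂
  have hSU : S₁.carrier ∩ S₂.carrier ⊆
      ((H₁ ⊓ H₂ : Submodule ℝ (EuclideanSpace ℝ (Fin d))) : Set (EuclideanSpace ℝ (Fin d))) := by
    rw [hS₁, hS₂]; exact fun y hy => ⟨hy.1.1, hy.2.1⟩
  -- a generic point of the intersection
  obtain ⟨x, hx, hxgen⟩ := exists_mem_forall_ne_zero (C := S₁.carrier ∩ S₂.carrier)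
    (by
      rw [hS₁, hS₂]
      exact fun y hy z hz ε hε => ⟨add_smul_mem_cell hy.1 hz.1 hε, add_smul_mem_cell hy.2 hz.2 hε⟩)
    hcod.1 (hA.finite.subset (Set.sep_subset A fun K => ¬ H₁ ⊓ H₂ ≤ K)) ν (by
      rintro K ⟨hK, hKU⟩
      refine hcod.exists_ne_zero
        (finrank_inf_add_two (hA.isHyperplane _ h₁) (hA.isHyperplane _ h₂) hne) hSU (ν K) ?_
      obtain ⟨y, hy, hy'⟩ := SetLike.not_le_iff_exists.1 hKU
      exact ⟨y, hy, (hν.ne_zero_iff hK y).2 hy'⟩)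
  have hxU : x ∈ H₁ ⊓ H₂ := hSU hx
  -- By genericity a cutter through `x` contains `H₁ ⊓ H₂`, so it belongs to the same rank-two
  -- subarrangement, where a basic hyperplane is not cut.
  have hxuncut : ∀ H, IsBasic (rankTwo A H₁ H₂) (cell ⊤ A ν b) H → x ∈ uncut A (cell ⊤ A ν b) H := by
    intro H hH
    refine ⟨hH.1.2 hxU, fun K hK hxK => ?_⟩
    have hKR : K ∈ rankTwo A H₁ H₂ := ⟨hK.1, by
      by_contra hKU
      exact hxgen K ⟨hK.1, hKU⟩ (((hν K hK.1).1 x).2 hxK)⟩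
    have := rankTwo_eq hA h₁ h₂ hne hKR hH.1 hK.2.2.1
    exact hK.2.2.2.2 (this ▸ hH)
  obtain ⟨S₁', hS₁'H, hxS₁'⟩ := exists_shard h₁' (hxuncut H₁' hb₁')
  have hu₁ := hxuncut H₁ hb₁
  have hu₁' := hxuncut H₁' hb₁'
  refine ⟨S₁', ⟨x, ?_, ?_⟩, ⟨?_, ?_, ?_⟩, ?_⟩
  · rw [S₁.intrinsicInterior_carrier hA hν]; exact ⟨hx.1, hu₁⟩
  · rw [S₁'.intrinsicInterior_carrier hA hν, hS₁'H]; exact ⟨hxS₁', hu₁'⟩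
  · rwa [hS₁'H]
  · rw [hS₁'H, hR]; exact right_mem_rankTwo h₂
  · rwa [hS₁'H, hR]
  · have hc₁ := S₁.carrier_eq_cell_of_mem hν hx.1 hu₁
    have hc₁' := S₁'.carrier_eq_cell_of_mem hν hxS₁' (hS₁'H ▸ hu₁')
    rw [← hH₁] at hc₁
    rw [hS₁'H] at hc₁'
    rw [hc₁, hc₁']
    rintro y ⟨hy₁, hy₁'⟩
    have hyU : y ∈ H₁ ⊓ H₂ := by
      refine ⟨hy₁.1, ((hν H₂ h₂).1 y).1 ?_⟩
      rw [hcomb]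
      simp [((hν H₁ h₁).1 y).2 hy₁.1, ((hν H₁' h₁').1 y).2 hy₁'.1]
    have hxS₂ := hx.2
    rw [hS₂] at hxS₂ ⊢
    refine ⟨hyU.2, fun K hK => ?_⟩
    have hKA : K ∈ A := hK.1
    by_cases hKU : H₁ ⊓ H₂ ≤ K
    · rw [((hν K hKA).1 y).2 (hKU hyU), mul_zero]
    have hKx := hxgen K ⟨hKA, hKU⟩
    have hx₂K : ν K x₂ ≠ 0 := (hν.ne_zero_iff hKA x₂).2 (hx₂.2 K hK)
    have hpos : 0 < ν K x₂ * ν K x := lt_of_le_of_ne (hxS₂.2 K hK) (mul_ne_zero hx₂K hKx).symm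
    by_contra! hneg
    have hyK : ν K y ≠ 0 := right_ne_zero_of_mul hneg.ne
    have hxy : ν K x * ν K y < 0 := by
      have h3 : (ν K x₂ * ν K x) * (ν K x₂ * ν K y) < 0 := mul_neg_of_pos_of_neg hpos hneg
      have h4 : 0 < ν K x₂ * ν K x₂ := mul_self_pos.2 hx₂K
      by_contra! h5
      have := mul_nonneg h4.le h5
      linarith
    -- the point where the segment from `x` to `y` meets `K`
    set z := (ν K y * ν K y) • x + (-(ν K x * ν K y)) • y with hz
    have hzK : z ∈ K := ((hν K hKA).1 z).1 (by simp [hz]; ring)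
    -- Both weights in `z` are positive, `x` is strictly inside the cell and `y` is in it, so no
    -- cutter vanishes at `z`.
    have hzuncut : ∀ H, x ∈ uncut A (cell ⊤ A ν b) H →
        y ∈ cell H (cutters A (cell ⊤ A ν b) H) ν x → z ∈ uncut A (cell ⊤ A ν b) H := by
      intro H hxH hyH
      refine ⟨H.add_mem (H.smul_mem _ hxH.1) (H.smul_mem _ hyH.1), fun L hL hzL => ?_⟩
      have h3 := hyH.2 L hL
      have h4 := mul_self_pos.2 ((hν.ne_zero_iff hL.1 x).2 (hxH.2 L hL))
      have h5 := ((hν L hL.1).1 z).2 hzL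
      have h6 : ν L x * ν L z = (ν K y * ν K y) * (ν L x * ν L x) +
          (-(ν K x * ν K y)) * (ν L x * ν L y) := by simp [hz]; ring
      rw [h5, mul_zero] at h6
      have h7 := mul_pos (mul_self_pos.2 hyK) h4
      have h8 := mul_nonneg (neg_pos.2 hxy).le h3
      linarith
    have hle := inf_le_of_cuts hA hsimp hν h₁ h₁' hcomb (hzuncut H₁ hu₁ hy₁)
      (hzuncut H₁' hu₁' hy₁') hK hzK
    exact hKx (((hν K hKA).1 x).2 (hle ⟨hxU.1, hb₁'.1.2 hxU⟩))

theorem adj_of_compatible (hA : IsArrangement A) (hν : IsNormal A b ν)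
    (S₁ S₂ S₁' : Shard A (cell ⊤ A ν b)) (hcomp : S₁.Compatible S₁')
    (hne : S₁.hyperplane ≠ S₁'.hyperplane)
    (hmem : S₂.hyperplane ∈ rankTwo A S₁.hyperplane S₁'.hyperplane)
    (hnb : ¬ IsBasic (rankTwo A S₁.hyperplane S₁'.hyperplane) (cell ⊤ A ν b) S₂.hyperplane)
    (hsub : S₁.carrier ∩ S₁'.carrier ⊆ S₂.carrier) :
    (shardDigraph A (cell ⊤ A ν b)).Adj S₁ S₂ := by
  obtain ⟨x, hx, hx'⟩ := hcomp
  rw [Shard.intrinsicInterior_carrier hA hν] at hx hx'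
  have h₁ := S₁.hyperplane_mem
  have h₁' := S₁'.hyperplane_mem
  have h₂ := S₂.hyperplane_mem
  have hb₁ := isBasic_of_mem_uncut hA hν h₁ h₁' hne hx.2 hx'.2.1
  have hne₂ : S₁.hyperplane ≠ S₂.hyperplane := fun h => hnb (h ▸ hb₁)
  have hR := rankTwo_eq hA h₁ h₁' hne (left_mem_rankTwo h₁) hmem hne₂
  refine ⟨⟨h₁, h₂, hne₂, hR ▸ hb₁, hR ▸ hnb⟩, ?_⟩
  have hc₁ := S₁.carrier_eq_cell_of_mem hν hx.1 hx.2
  have hc₁' := S₁'.carrier_eq_cell_of_mem hν hx'.1 hx'.2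
  have hu₁ := hx.2
  have hu₁' := hx'.2
  rw [uncut_eq hν] at hu₁ hu₁'
  refine hasCodim_of_cell_subset
    (finrank_inf_add_two (hA.isHyperplane _ h₁) (hA.isHyperplane _ h₁') hne)
    (hA.finite.subset (Set.union_subset (cutters_subset A (cell ⊤ A ν b) S₁.hyperplane)
      (cutters_subset A (cell ⊤ A ν b) S₁'.hyperplane))) (ν := ν) (x := x)
    ⟨⟨hu₁.1, hu₁'.1⟩, fun K hK => hK.elim (hu₁.2 K) (hu₁'.2 K)⟩ ?_ ?_
  · intro y hy
    have hy₁ : y ∈ S₁.carrier := by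
      rw [hc₁]; exact ⟨hy.1.1, fun K hK => hy.2 K (Or.inl hK)⟩
    have hy₁' : y ∈ S₁'.carrier := by
      rw [hc₁']; exact ⟨hy.1.2, fun K hK => hy.2 K (Or.inr hK)⟩
    exact ⟨hy₁, hsub ⟨hy₁, hy₁'⟩⟩
  · rintro y ⟨hy₁, hy₂⟩
    obtain ⟨x₂, -, hS₂⟩ := S₂.carrier_eq_cell hν
    rw [hc₁] at hy₁
    rw [hS₂] at hy₂
    have : S₁'.hyperplane ∈ rankTwo A S₁.hyperplane S₂.hyperplane := by
      rw [hR]; exact right_mem_rankTwo h₁'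
    exact ⟨hy₁.1, this.2 ⟨hy₁.1, hy₂.1⟩⟩

end Arrangement

end HypArr

theorem mainTheorem2 {d : ℕ} (A : Set (Submodule ℝ (EuclideanSpace ℝ (Fin d))))
    (hA : HypArr.IsArrangement A) (hsimp : HypArr.IsSimplicial A)
    (B : Set (EuclideanSpace ℝ (Fin d))) (hB : HypArr.IsRegion A B)
    (S₁ S₂ : HypArr.Shard A B) :
    (HypArr.shardDigraph A B).Adj S₁ S₂ ↔
      ∃ S₁' : HypArr.Shard A B,
        S₁.Compatible S₁' ∧
        (S₁.hyperplane ≠ S₁'.hyperplane ∧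
          S₂.hyperplane ∈ HypArr.rankTwo A S₁.hyperplane S₁'.hyperplane ∧
          ¬ HypArr.IsBasic (HypArr.rankTwo A S₁.hyperplane S₁'.hyperplane) B S₂.hyperplane) ∧
        S₁.carrier ∩ S₁'.carrier ⊆ S₂.carrier := by
  obtain ⟨b, hb, rfl⟩ := hB
  obtain ⟨ν, hν⟩ := hA.exists_isNormal hb
  -- The type of shards depends on the base region, which is about to be rewritten as a cell.
  revert S₁ S₂
  rw [HypArr.closure_component_complement hν hb]
  intro S₁ S₂
  exact ⟨HypArr.exists_compatible_of_adj hA hsimp hν S₁ S₂,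
    fun ⟨S₁', hcomp, ⟨hne, hmem, hnb⟩, hsub⟩ =>
      HypArr.adj_of_compatible hA hν S₁ S₂ S₁' hcomp hne hmem hnb hsub⟩
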